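/- **Setting.** An additive noise $L$-unicast wireless network consists of a finite directed graph $(V,E)$, a real gain $h_{u,v}$ for each edge, and $2L$ distinct nodes $s_1,\dots,s_L,d_1,\dots,d_L\in V$ (sources and destinations). At time $t$ node $v$ receives $Y_v[t]=\sum_{u:(u,v)\in E}h_{u,v}X_u[t]+N_v[t]$, where $X_u[t]$ is the signal transmitted by $u$ and the noises $N_v[t]$ are real, independent over nodes and times, identically distributed over time, independent of the messages, with mean $0$ and variance $\sigma_v^2<\infty$. If all noises are $\mathcal N(0,\sigma_v^2)$, the network is an AWGN network. A coding scheme with block length $n$ and rate tuple $\vec R=(R_1,\dots,R_L)\in\mathbb R^L$ consists of encoding functions $f_i:\{1,\dots,\lfloor 2^{nR_i}\rfloor\}\to\mathbb R^n$ for the sources, (measurable) relaying functions $r_v^{(t)}$, $0\le t\le n-1$, giving the signal $X_v[t]=r_v^{(t)}(Y_v[0],\dots,Y_v[t-1])$ of every node $v$ that is not a source, and (measurable) decoding functions $g_i:\mathbb R^n\to\{1,\dots,\lfloor 2^{nR_i}\rfloor\}$ for the destinations; the average power over the block is at most $P$ for every codeword, and for every non-source node whatever it receives. Its error probability is the probability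 that $g_i(Y_{d_i}[0],\dots,Y_{d_i}[n-1])\neq W_i$ for some $i$, the messages $W_i$ being independent and uniform. A sequence $(\mathcal C_n)_{n\ge1}$ of coding schemes, $\mathcal C_n$ with block length $n$ and rate tuple $\vec R$, achieves $\vec R$ if the error probability of $\mathcal C_n$ tends to $0$. A coding scheme has finite reading precision $\rho\in\{1,2,\dots\}$ if its relaying and decoding functions do not change when each received signal $y$ is replaced by $2^{-\rho}\lfloor 2^{\rho}y\rfloor$. **Theorem.** Suppose that $\vec R$ is achieved on an AWGN $L$-unicast wireless network with noise variances $\sigma_v^2$ by a sequence of coding schemes $\mathcal C_n$, each of some finite reading precision $\rho_n$ ($\rho_n$ may vary arbitrarily with $n$). Then for every $\varepsilon>0$ there are a rate tuple $\vec R'$ with $|R'_i-R_i|<\varepsilon$ for all $i$ and a single sequence of coding schemes with rate tuple $\vec R'$ (not necessarily of finite reading precision) which, on the same network with the same power constraint, achieves $\vec R'$ for every choice of the distributions of the noises $N_v$, $v\in V$, with $E[N_v]=0$ and $E[N_v^2]=\sigma_v^2$. -/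

import Mathlib

open MeasureTheory ProbabilityTheory Filter Topology
open scoped NNReal

/-- An `L`-unicast wireless network on the node set `V`: a directed graph, a real channel gain for
each edge (the values of `gain` at non-edges are never used), `L` sources and `L` destinations,
all `2 * L` of them distinct nodes. -/
structure UnicastNetwork (V : Type*) (L : ℕ) where
  /-- The directed graph; `graph.Adj u v` says that `(u, v)` is an edge. -/
  graph : Digraph V
  /-- `gain u v` is the channel gain from `u` to `v`. -/
  gain : V → V → ℝ
  /-- The source nodes. -/
  src : Fin L → V
  /-- The destination nodes. -/
  dst : Fin L → V
  src_injective : Function.Injective src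
  dst_injective : Function.Injective dst
  src_ne_dst : ∀ i j, src i ≠ dst j

/-- The nodes that are not sources (destinations are among them). -/
abbrev UnicastNetwork.NonSource {V : Type*} {L : ℕ} (N : UnicastNetwork V L) : Type _ :=
  {v : V // v ∉ Set.range N.src}

/-- The message set `{1, …, 2 ^ (n r)}`: there are `⌊2 ^ (n r)⌋` messages. -/
abbrev MessageSet (n : ℕ) (r : ℝ) : Type := Fin ⌊(2 : ℝ) ^ ((n : ℝ) * r)⌋₊

/-- The first `t` entries of a block of length `n`. -/
def pastOf {n : ℕ} (y : Fin n → ℝ) (t : Fin n) : Fin (t : ℕ) → ℝ :=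
  fun s => y (Fin.castLE t.isLt.le s)

/-- Coding schemes with block length `n` and rate tuple `R`, under the average power constraint `P`.
The relaying function at time `t` sees the signals received at the times `0, …, t - 1`. -/
structure CodingScheme {V : Type*} {L : ℕ} (N : UnicastNetwork V L) (P : ℝ) (n : ℕ)
    (R : Fin L → ℝ) where
  /-- The encoding functions of the sources. -/
  enc : (i : Fin L) → MessageSet n (R i) → Fin n → ℝ
  /-- The relaying functions of all nodes that are not sources. -/
  relay : N.NonSource → (t : Fin n) → (Fin (t : ℕ) → ℝ) → ℝ
  /-- The decoding functions of the destinations. -/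
  dec : (i : Fin L) → (Fin n → ℝ) → MessageSet n (R i)
  enc_power : ∀ (i : Fin L) (w : MessageSet n (R i)),
    (1 / (n : ℝ)) * ∑ t : Fin n, (enc i w t) ^ 2 ≤ P
  relay_power : ∀ (v : N.NonSource) (y : Fin n → ℝ),
    (1 / (n : ℝ)) * ∑ t : Fin n, (relay v t (pastOf y t)) ^ 2 ≤ P
  relay_measurable : ∀ (v : N.NonSource) (t : Fin n), Measurable (relay v t)
  dec_measurable : ∀ i : Fin L, Measurable (dec i)

/-- The truncation `⌊x⌋_ρ = 2 ^ (-ρ) * ⌊2 ^ ρ * x⌋` to `ρ` binary digits. -/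
noncomputable def truncate (ρ : ℕ) (x : ℝ) : ℝ := ((2 : ℝ) ^ ρ)⁻¹ * (⌊(2 : ℝ) ^ ρ * x⌋ : ℝ)

/-- The law of the additive noise over a block of length `n`, when `ν v` is the law of the noise at
node `v`: the noise variables of distinct (node, time) pairs are independent. -/
noncomputable def noiseLaw {V : Type*} [Fintype V] (ν : V → Measure ℝ) (n : ℕ) :
    Measure (V × Fin n → ℝ) :=
  Measure.pi (fun p => ν p.1)

/-- `ν` is a probability law on `ℝ` with mean zero and (finite) variance `s`. -/
structure IsNoiseLaw (ν : Measure ℝ) (s : ℝ≥0) : Prop where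
  isProbabilityMeasure : IsProbabilityMeasure ν
  memLp : MemLp (fun x : ℝ => x) 2 ν
  mean_eq_zero : ∫ x, x ∂ν = 0
  second_moment_eq : ∫ x, x ^ 2 ∂ν = (s : ℝ)

namespace CodingScheme

variable {V : Type*} {L : ℕ} {N : UnicastNetwork V L} {P : ℝ} {n : ℕ} {R : Fin L → ℝ}

open scoped Classical in
/-- The signal that node `u` transmits at time `t`, when the messages are `w` and the signals
received by `u` before time `t` are `past`. -/
noncomputable def transmit (C : CodingScheme N P n R) (w : (i : Fin L) → MessageSet n (R i))
    (u : V) (t : Fin n) (past : Fin (t : ℕ) → ℝ) : ℝ :=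
  if h : u ∈ Set.range N.src then C.enc h.choose (w h.choose) t else C.relay ⟨u, h⟩ t past

open scoped Classical in
/-- The signal that node `v` receives at time `t`, when the messages are `w` and the noise
realization over the block is `z`. -/
noncomputable def receivedAt [Fintype V] (C : CodingScheme N P n R)
    (w : (i : Fin L) → MessageSet n (R i)) (z : V × Fin n → ℝ) (t : ℕ) (ht : t < n) (v : V) : ℝ :=
  (∑ u : V with N.graph.Adj u v,
    N.gain u v * C.transmit w u ⟨t, ht⟩
      (fun s : Fin t => receivedAt C w z s (s.isLt.trans ht) u)) + z (v, ⟨t, ht⟩)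
termination_by t
decreasing_by exact s.isLt

/-- The block of signals received by node `v`. -/
noncomputable def received [Fintype V] (C : CodingScheme N P n R)
    (w : (i : Fin L) → MessageSet n (R i)) (z : V × Fin n → ℝ) (v : V) : Fin n → ℝ :=
  fun t => C.receivedAt w z t t.isLt v

open scoped Classical in
/-- The channel model: the received signal is the sum of the transmit signals of the in-neighbours,
scaled by the channel gains, and of the noise. -/
theorem received_eq [Fintype V] (C : CodingScheme N P n R)
    (w : (i : Fin L) → MessageSet n (R i)) (z : V × Fin n → ℝ) (v : V) (t : Fin n) :
    C.received w z v t = (∑ u : V with N.graph.Adj u v,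
      N.gain u v * C.transmit w u t (pastOf (C.received w z u) t)) + z (v, t) := by
  unfold received
  rw [receivedAt]
  rfl

/-- The noise realizations for which some destination decodes incorrectly, for given messages. -/
def errorSet [Fintype V] (C : CodingScheme N P n R) (w : (i : Fin L) → MessageSet n (R i)) :
    Set (V × Fin n → ℝ) :=
  {z | ∃ i : Fin L, w i ≠ C.dec i (C.received w z (N.dst i))}

/-- The error probability when the noise at node `v` has law `ν v` and the messages are independent
of the noise, independent of each other, and uniformly distributed. -/
noncomputable def errorProb [Fintype V] (C : CodingScheme N P n R) (ν : V → Measure ℝ) : ℝ :=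
  (∑ w : (i : Fin L) → MessageSet n (R i), (noiseLaw ν n).real (C.errorSet w)) /
    (Fintype.card ((i : Fin L) → MessageSet n (R i)) : ℝ)

/-- All relaying and decoding functions read the received signals only up to `ρ` binary digits. -/
def HasReadingPrecision (C : CodingScheme N P n R) (ρ : ℕ) : Prop :=
  (∀ (v : N.NonSource) (t : Fin n) (y : Fin (t : ℕ) → ℝ),
    C.relay v t y = C.relay v t (fun s => truncate ρ (y s))) ∧
  (∀ (i : Fin L) (y : Fin n → ℝ), C.dec i y = C.dec i (fun s => truncate ρ (y s)))

end CodingScheme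

/-- The sequence of coding schemes `C 1, C 2, …`, where `C n` has block length `n` and rate tuple
`R`, achieves `R` when the noise at each node `v` has law `ν v`. -/
def Achieves {V : Type*} [Fintype V] {L : ℕ} {N : UnicastNetwork V L} {P : ℝ} {R : Fin L → ℝ}
    (C : (n : ℕ+) → CodingScheme N P n R) (ν : V → Measure ℝ) : Prop :=
  Tendsto (fun n : ℕ+ => (C n).errorProb ν) atTop (𝓝 0)

/-- The rate tuple `R` is achievable by coding schemes with finite reading precision; the precision
may vary arbitrarily along the sequence. -/
def AchievableWithFinitePrecision {V : Type*} [Fintype V] {L : ℕ} (N : UnicastNetwork V L) (P : ℝ)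
    (ν : V → Measure ℝ) (R : Fin L → ℝ) : Prop :=
  ∃ (C : (n : ℕ+) → CodingScheme N P n R) (ρ : ℕ+ → ℕ),
    (∀ n, 0 < ρ n ∧ (C n).HasReadingPrecision (ρ n)) ∧ Achieves C ν

/-- The noise laws of the AWGN network with noise variances `σsq v`. -/
noncomputable def awgn {V : Type*} (σsq : V → ℝ≥0) : V → Measure ℝ :=
  fun v => gaussianReal 0 (σsq v)

/-! Fix one scheme `C` of block length `n` whose Gaussian error probability is below a small
constant `δ`. Run `b` copies of it in parallel: nodes send the image of the copies' symbols under an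
orthogonal matrix with entries `±1/√b`, and receivers undo the transform. The channel is linear and
constant in time, so each copy sees the original network, with noise replaced by a signed average
`b^(-1/2) ∑ ± N` (`despread_received_interleave`). By the central limit theorem
(`tendsto_mixLaw_Ico`) this noise is nearly Gaussian whatever the law of `N`. Finite reading
precision makes the error set a countable union of boxes with half-open sides, so the error
probability converges too (`CodingScheme.HasReadingPrecision.tendsto_errorProb`) and each copy fails
with probability below `δ` once `b` is large.

The speed of the central limit theorem depends on the unknown noise law, so `n` stays fixed and `δ`
does not tend to `0`. An outer code over the copies removes this constant error. There are `k`
groups of `b` copies; noise is independent between groups but possibly dependent within one. A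
second moment bound still works (`sum_measureReal_many_bad_le`): only `k b²` of the `(k b)²` pairs
of copies can be correlated, so too large a fraction of failures has probability `O(1/k)`. Since
inner error probabilities are averages over messages, pairs of outer symbols must be independent and
uniform; random linear codes achieve this together with a large minimum distance
(`exists_linear_code`).

`CodingScheme.exists_interleaved` combines the pieces. The parameters `b` and `k` are functions of
the total block length alone, so one sequence of schemes serves all noise laws. -/

namespace CodingScheme

/-! ### Uniqueness of the solution of the channel equations -/

variable {V : Type*} {L : ℕ} {N : UnicastNetwork V L} {P : ℝ} {n : ℕ} {R : Fin L → ℝ}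

open scoped Classical in
/-- The received signals are the only solution of the channel equations. -/
theorem received_unique [Fintype V] (C : CodingScheme N P n R)
    (w : (i : Fin L) → MessageSet n (R i)) (z : V × Fin n → ℝ) (Y : V → Fin n → ℝ)
    (hY : ∀ v t, Y v t = (∑ u : V with N.graph.Adj u v,
      N.gain u v * C.transmit w u t (pastOf (Y u) t)) + z (v, t)) (v : V) :
    Y v = C.received w z v := by
  have key : ∀ (t : ℕ) (ht : t < n) (v : V), Y v ⟨t, ht⟩ = C.received w z v ⟨t, ht⟩ := by
    intro t
    induction t using Nat.strong_induction_on with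
    | _ t ih =>
      intro ht v
      rw [hY, received_eq]
      congr 1
      refine Finset.sum_congr rfl fun u _ => ?_
      congr 2
      funext s
      exact ih s s.isLt (s.isLt.trans ht) u
  funext t
  exact key t t.isLt v

end CodingScheme

/-! ### Time slots and orthogonal spreading -/

section Interleaving

variable {k n b m : ℕ}

/-- The time at which group `p.1` sends, during its `p.2.1`-th inner time step, its `p.2.2`-th
transform coordinate. -/
def slot (h : k * (n * b) ≤ m) (p : Fin k × Fin n × Fin b) : Fin m :=
  Fin.castLE h (finProdFinEquiv (p.1, finProdFinEquiv p.2))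

lemma slot_injective (h : k * (n * b) ≤ m) : Function.Injective (slot h) := by
  rintro ⟨g, p⟩ ⟨g', p'⟩ hpp
  have := finProdFinEquiv.injective (Fin.castLE_injective h hpp)
  simp only [Prod.mk.injEq, EmbeddingLike.apply_eq_iff_eq] at this
  rw [this.1, this.2]

/-- Slots are ordered by group, then inner time, then transform coordinate. All coordinates of an
inner step are therefore received before the next step begins, which makes relaying causal. -/
lemma slot_lt_slot (h : k * (n * b) ≤ m) (g : Fin k) {s t : Fin n} (hst : s < t) (j j' : Fin b) :
    slot h (g, s, j) < slot h (g, t, j') := by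
  have h1 : (s : ℕ) + 1 ≤ t := hst
  have h2 : b * ((s : ℕ) + 1) ≤ b * t := Nat.mul_le_mul_left b h1
  have h3 := j.isLt
  simp only [slot, Fin.lt_def, Fin.val_castLE, finProdFinEquiv_apply_val]
  rw [mul_add, mul_one] at h2
  omega

open scoped Classical in
/-- The signal sent at time `τ` when the inner codewords `a g l` of the groups `g` are transformed
by `Q`, and zero outside of the groups. -/
noncomputable def spread (h : k * (n * b) ≤ m) (Q : Fin b → Fin b → ℝ)
    (a : Fin k → Fin b → Fin n → ℝ) (τ : Fin m) : ℝ :=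
  if hp : ∃ p, slot h p = τ then
    ∑ l, Q l hp.choose.2.2 * a hp.choose.1 l hp.choose.2.1
  else 0

lemma spread_slot (h : k * (n * b) ≤ m) (Q : Fin b → Fin b → ℝ) (a : Fin k → Fin b → Fin n → ℝ)
    (g : Fin k) (t : Fin n) (j : Fin b) :
    spread h Q a (slot h (g, t, j)) = ∑ l, Q l j * a g l t := by
  have hp : ∃ p, slot h p = slot h (g, t, j) := ⟨_, rfl⟩
  have hc : hp.choose = (g, t, j) := slot_injective h hp.choose_spec
  rw [spread, dif_pos hp, hc]

lemma spread_eq_zero (h : k * (n * b) ≤ m) (Q : Fin b → Fin b → ℝ) (a : Fin k → Fin b → Fin n → ℝ)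
    (τ : Fin m) (hτ : τ ∉ Set.range (slot h)) : spread h Q a τ = 0 := by
  rw [spread, dif_neg]
  exact hτ

/-- The transform coordinate of a received block that is addressed to the `l`-th inner scheme of
group `g`. -/
def despread (h : k * (n * b) ≤ m) (Q : Fin b → Fin b → ℝ) (y : Fin m → ℝ) (g : Fin k) (l : Fin b)
    (t : Fin n) : ℝ :=
  ∑ j, Q l j * y (slot h (g, t, j))

/-- Parseval: the rows of `Q` are orthonormal, and idle slots carry no power. -/
lemma sum_sq_spread (h : k * (n * b) ≤ m) {Q : Fin b → Fin b → ℝ}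
    (hQ : ∀ l l', ∑ j, Q l j * Q l' j = if l = l' then 1 else 0) (a : Fin k → Fin b → Fin n → ℝ) :
    ∑ τ, (spread h Q a τ) ^ 2 = ∑ g, ∑ l, ∑ t, (a g l t) ^ 2 := by
  have h1 : ∑ τ, (spread h Q a τ) ^ 2 = ∑ p, (spread h Q a (slot h p)) ^ 2 := by
    rw [← Finset.sum_image (s := Finset.univ) (g := slot h)
      (f := fun τ => (spread h Q a τ) ^ 2) (fun _ _ _ _ hp => slot_injective h hp)]
    symm
    refine Finset.sum_subset (Finset.subset_univ _) fun τ _ hτ => ?_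
    rw [spread_eq_zero h Q a τ (by simpa using hτ)]
    simp
  rw [h1, Fintype.sum_prod_type]
  refine Finset.sum_congr rfl fun g _ => ?_
  rw [Fintype.sum_prod_type, Finset.sum_comm (s := (Finset.univ : Finset (Fin b)))]
  refine Finset.sum_congr rfl fun t _ => ?_
  simp only [spread_slot, sq, Finset.sum_mul_sum]
  rw [Finset.sum_comm]
  refine Finset.sum_congr rfl fun l _ => ?_
  rw [Finset.sum_comm]
  have : ∀ l', ∑ j, Q l j * a g l t * (Q l' j * a g l' t)
      = (∑ j, Q l j * Q l' j) * (a g l t * a g l' t) := by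
    intro l'
    rw [Finset.sum_mul]
    exact Finset.sum_congr rfl fun j _ => by ring
  simp [this, hQ]

lemma power_spread_le (h : k * (n * b) ≤ m) {Q : Fin b → Fin b → ℝ}
    (hQ : ∀ l l', ∑ j, Q l j * Q l' j = if l = l' then 1 else 0) (a : Fin k → Fin b → Fin n → ℝ)
    {P : ℝ} (hP : 0 ≤ P) (ha : ∀ g l, (1 / (n : ℝ)) * ∑ t, (a g l t) ^ 2 ≤ P) :
    (1 / (m : ℝ)) * ∑ τ, (spread h Q a τ) ^ 2 ≤ P := by
  have ha' : ∀ g l, ∑ t, (a g l t) ^ 2 ≤ n * P := by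
    intro g l
    rcases Nat.eq_zero_or_pos n with rfl | hn
    · simp
    · have := ha g l
      rwa [one_div, inv_mul_le_iff₀ (by positivity)] at this
  have h2 : ∑ τ, (spread h Q a τ) ^ 2 ≤ m * P := by
    rw [sum_sq_spread h hQ]
    calc ∑ g, ∑ l, ∑ t, (a g l t) ^ 2 ≤ ∑ _g : Fin k, ∑ _l : Fin b, n * P :=
          Finset.sum_le_sum fun g _ => Finset.sum_le_sum fun l _ => ha' g l
      _ = ((k * (n * b) : ℕ) : ℝ) * P := by simp; ring
      _ ≤ m * P := by gcongr
  rcases Nat.eq_zero_or_pos m with rfl | hm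
  · simpa using hP
  · rwa [one_div, inv_mul_le_iff₀ (by positivity)]

/-- Extension of the first `t` entries of a block of length `m` by zeros. -/
def zeroExtend {t : ℕ} (m : ℕ) (y : Fin t → ℝ) : Fin m → ℝ :=
  fun p => if hp : (p : ℕ) < t then y ⟨p, hp⟩ else 0

lemma measurable_zeroExtend (t m : ℕ) : Measurable (zeroExtend (t := t) m) := by
  refine measurable_pi_lambda _ fun p => ?_
  unfold zeroExtend
  split_ifs
  · exact measurable_pi_apply _
  · exact measurable_const

lemma measurable_despread (h : k * (n * b) ≤ m) (Q : Fin b → Fin b → ℝ) (g : Fin k) (l : Fin b) :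
    Measurable (fun y => despread h Q y g l) := by
  refine measurable_pi_lambda _ fun t => ?_
  unfold despread
  fun_prop

/-- At a slot of inner step `t`, everything needed about inner steps before `t` has already arrived,
so the padding zeros are never read. -/
lemma pastOf_despread_zeroExtend (h : k * (n * b) ≤ m) (Q : Fin b → Fin b → ℝ) (y : Fin m → ℝ)
    (g : Fin k) (l : Fin b) (t : Fin n) (j : Fin b) :
    pastOf (despread h Q (zeroExtend m (pastOf y (slot h (g, t, j)))) g l) t
      = pastOf (despread h Q y g l) t := by
  funext s
  simp only [pastOf, despread]
  refine Finset.sum_congr rfl fun j' _ => ?_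
  congr 1
  have hlt : slot h (g, Fin.castLE t.isLt.le s, j') < slot h (g, t, j) :=
    slot_lt_slot h g (by simp [Fin.lt_def]) j' j
  rw [zeroExtend, dif_pos (by simpa using hlt)]
  rfl

end Interleaving

/-! ### The interleaved scheme -/

namespace CodingScheme

variable {V : Type*} {L : ℕ} {N : UnicastNetwork V L} {P : ℝ} {n : ℕ} {R : Fin L → ℝ}

/-- The signals that a relay sends when it runs the inner schemes of all groups on the transform
coordinates of `y`. -/
noncomputable def relayBlock {k b m : ℕ} (C : CodingScheme N P n R) (h : k * (n * b) ≤ m)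
    (Q : Fin b → Fin b → ℝ) (v : N.NonSource) (y : Fin m → ℝ) : Fin m → ℝ :=
  spread h Q fun g l t => C.relay v t (pastOf (despread h Q y g l) t)

/-- Lets power and channel equations be checked on whole blocks, although a relay sees only the
past. -/
lemma relayBlock_zeroExtend {k b m : ℕ} (C : CodingScheme N P n R) (h : k * (n * b) ≤ m)
    (Q : Fin b → Fin b → ℝ) (v : N.NonSource) (y : Fin m → ℝ) (τ : Fin m) :
    C.relayBlock h Q v (zeroExtend m (pastOf y τ)) τ = C.relayBlock h Q v y τ := by
  by_cases hτ : τ ∈ Set.range (slot h)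
  · obtain ⟨⟨g, t, j⟩, rfl⟩ := hτ
    simp only [relayBlock, spread_slot, pastOf_despread_zeroExtend]
  · simp only [relayBlock, spread_eq_zero h Q _ τ hτ]

lemma measurable_relayBlock {k b m : ℕ} (C : CodingScheme N P n R) (h : k * (n * b) ≤ m)
    (Q : Fin b → Fin b → ℝ) (v : N.NonSource) (τ : Fin m) :
    Measurable fun y => C.relayBlock h Q v y τ := by
  by_cases hτ : τ ∈ Set.range (slot h)
  · obtain ⟨⟨g, t, j⟩, rfl⟩ := hτ
    simp only [relayBlock, spread_slot]
    refine Finset.measurable_sum _ fun l _ => ?_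
    refine Measurable.const_mul ?_ _
    refine (C.relay_measurable v t).comp ?_
    have : Measurable fun y : Fin n → ℝ => pastOf y t :=
      measurable_pi_lambda _ fun s => measurable_pi_apply _
    exact this.comp (measurable_despread h Q g l)
  · simp only [relayBlock, spread_eq_zero h Q _ τ hτ]
    exact measurable_const

/-- The scheme of block length `m` that runs `k` groups of `b` copies of `C`, the copies of a group
in parallel and combined by the orthogonal transform `Q`, with outer codes `cw` and decoders
`dcd`. -/
noncomputable def interleave {k b m : ℕ} (C : CodingScheme N P n R) (h : k * (n * b) ≤ m)
    {Q : Fin b → Fin b → ℝ} (hQ : ∀ l l', ∑ j, Q l j * Q l' j = if l = l' then 1 else 0)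
    (hP : 0 ≤ P) {R' : Fin L → ℝ}
    (cw : (i : Fin L) → MessageSet m (R' i) → Fin k → Fin b → MessageSet n (R i))
    (dcd : (i : Fin L) → (Fin k → Fin b → MessageSet n (R i)) → MessageSet m (R' i)) :
    CodingScheme N P m R' where
  enc i x := spread h Q fun g l => C.enc i (cw i x g l)
  relay v τ past := C.relayBlock h Q v (zeroExtend m past) τ
  dec i y := dcd i fun g l => C.dec i (despread h Q y g l)
  enc_power i x := power_spread_le h hQ _ hP fun g l => C.enc_power i _
  relay_power v y := by
    simp only [relayBlock_zeroExtend]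
    exact power_spread_le h hQ _ hP fun g l => C.relay_power v _
  relay_measurable v τ :=
    (C.measurable_relayBlock h Q v τ).comp (measurable_zeroExtend _ _)
  dec_measurable i := by
    refine (measurable_of_countable (dcd i)).comp ?_
    refine measurable_pi_lambda _ fun g => measurable_pi_lambda _ fun l => ?_
    exact (C.dec_measurable i).comp (measurable_despread h Q g l)

/-- The noise seen by the `l`-th inner scheme of group `g`. -/
def innerNoise {k b m : ℕ} (h : k * (n * b) ≤ m) (Q : Fin b → Fin b → ℝ) (z : V × Fin m → ℝ)
    (g : Fin k) (l : Fin b) : V × Fin n → ℝ :=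
  fun p => ∑ j, Q l j * z (p.1, slot h (g, p.2, j))

lemma despread_received_interleave [Fintype V] {k b m : ℕ} (C : CodingScheme N P n R)
    (h : k * (n * b) ≤ m)
    {Q : Fin b → Fin b → ℝ} (hQ : ∀ l l', ∑ j, Q l j * Q l' j = if l = l' then 1 else 0)
    (hP : 0 ≤ P) {R' : Fin L → ℝ}
    (cw : (i : Fin L) → MessageSet m (R' i) → Fin k → Fin b → MessageSet n (R i))
    (dcd : (i : Fin L) → (Fin k → Fin b → MessageSet n (R i)) → MessageSet m (R' i))
    (x : (i : Fin L) → MessageSet m (R' i)) (z : V × Fin m → ℝ) (g : Fin k) (l : Fin b) (v : V) :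
    despread h Q ((C.interleave h hQ hP cw dcd).received x z v) g l =
      C.received (fun i => cw i (x i) g l) (innerNoise h Q z g l) v := by
  classical
  set D := C.interleave h hQ hP cw dcd with hD
  set Y := D.received x z with hYdef
  -- By uniqueness it is enough that the despread signals satisfy the channel equations of `C` with
  -- noise `innerNoise`.
  refine C.received_unique _ _ (fun v => despread h Q (Y v) g l) (fun v t => ?_) v
  have htr : ∀ u (t : Fin n) (j : Fin b),
      D.transmit x u (slot h (g, t, j)) (pastOf (Y u) (slot h (g, t, j))) =
        ∑ l, Q l j * C.transmit (fun i => cw i (x i) g l) u t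
          (pastOf (despread h Q (Y u) g l) t) := by
    intro u t j
    by_cases hu : u ∈ Set.range N.src
    · simp only [transmit, dif_pos hu]
      exact spread_slot h Q (fun g l => C.enc hu.choose (cw _ (x hu.choose) g l)) g t j
    · simp only [transmit, dif_neg hu]
      change C.relayBlock h Q _ (zeroExtend m _) _ = _
      rw [relayBlock_zeroExtend, relayBlock, spread_slot]
  have hrec : ∀ j, Y v (slot h (g, t, j)) = _ := fun j => D.received_eq x z v (slot h (g, t, j))
  simp only [despread, hrec, mul_add, Finset.sum_add_distrib, innerNoise]
  congr 1
  simp only [Finset.mul_sum]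
  rw [Finset.sum_comm]
  refine Finset.sum_congr (by congr) fun u _ => ?_
  rw [← hYdef]
  simp only [htr]
  have : ∀ j, Q l j * (N.gain u v * ∑ l', Q l' j *
        C.transmit (fun i => cw i (x i) g l') u t (pastOf (despread h Q (Y u) g l') t)) =
      ∑ l', (Q l j * Q l' j) * (N.gain u v *
        C.transmit (fun i => cw i (x i) g l') u t (pastOf (despread h Q (Y u) g l') t)) := by
    intro j
    rw [Finset.mul_sum, Finset.mul_sum]
    exact Finset.sum_congr rfl fun l' _ => by ring
  simp only [this]
  rw [Finset.sum_comm]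
  -- Orthonormality removes the interference of all copies other than `l`.
  simp only [← Finset.sum_mul, hQ]
  simp

lemma exists_of_mem_errorSet_interleave [Fintype V] {k b m : ℕ} (C : CodingScheme N P n R)
    (h : k * (n * b) ≤ m)
    {Q : Fin b → Fin b → ℝ} (hQ : ∀ l l', ∑ j, Q l j * Q l' j = if l = l' then 1 else 0)
    (hP : 0 ≤ P) {R' : Fin L → ℝ}
    (cw : (i : Fin L) → MessageSet m (R' i) → Fin k → Fin b → MessageSet n (R i))
    (dcd : (i : Fin L) → (Fin k → Fin b → MessageSet n (R i)) → MessageSet m (R' i))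
    (x : (i : Fin L) → MessageSet m (R' i)) {z : V × Fin m → ℝ}
    (hz : z ∈ (C.interleave h hQ hP cw dcd).errorSet x) :
    ∃ i, x i ≠ dcd i fun g l =>
      C.dec i (C.received (fun i => cw i (x i) g l) (innerNoise h Q z g l) (N.dst i)) := by
  obtain ⟨i, hi⟩ := hz
  refine ⟨i, ?_⟩
  simp only [← C.despread_received_interleave h hQ hP cw dcd]
  exact hi

end CodingScheme

/-! ### Readings of a scheme of finite precision -/

namespace CodingScheme

variable {V : Type*} {L : ℕ} {N : UnicastNetwork V L} {P : ℝ} {n : ℕ} {R : Fin L → ℝ}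

/-- The integer parts, at precision `ρ`, of all received signals. -/
noncomputable def readings [Fintype V] (C : CodingScheme N P n R)
    (w : (i : Fin L) → MessageSet n (R i)) (ρ : ℕ) (z : V × Fin n → ℝ) : V × Fin n → ℤ :=
  fun p => ⌊(2 : ℝ) ^ ρ * C.received w z p.1 p.2⌋

open scoped Classical in
/-- The noiseless received signal at `p` when all readings are given by `x`. -/
noncomputable def signalOf [Fintype V] (C : CodingScheme N P n R)
    (w : (i : Fin L) → MessageSet n (R i)) (ρ : ℕ) (x : V × Fin n → ℤ) (p : V × Fin n) : ℝ :=
  ∑ u : V with N.graph.Adj u p.1, N.gain u p.1 * C.transmit w u p.2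
    (pastOf (fun t => ((2 : ℝ) ^ ρ)⁻¹ * (x (u, t) : ℝ)) p.2)

lemma HasReadingPrecision.transmit_eq {C : CodingScheme N P n R} {ρ : ℕ}
    (hC : C.HasReadingPrecision ρ) (w : (i : Fin L) → MessageSet n (R i)) (u : V) (t : Fin n)
    (y : Fin (t : ℕ) → ℝ) :
    C.transmit w u t y = C.transmit w u t (fun s => truncate ρ (y s)) := by
  unfold transmit
  split_ifs with hu
  · rfl
  · exact hC.1 _ t y

/-- Noise realizations with given readings form a box of half-open intervals. -/
lemma HasReadingPrecision.readings_eq_iff [Fintype V] {C : CodingScheme N P n R} {ρ : ℕ}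
    (hC : C.HasReadingPrecision ρ) (w : (i : Fin L) → MessageSet n (R i)) (x : V × Fin n → ℤ)
    (z : V × Fin n → ℝ) :
    C.readings w ρ z = x ↔ ∀ p, z p ∈ Set.Ico (((2 : ℝ) ^ ρ)⁻¹ * x p - C.signalOf w ρ x p)
      (((2 : ℝ) ^ ρ)⁻¹ * (x p + 1) - C.signalOf w ρ x p) := by
  classical
  have h2 : (0 : ℝ) < 2 ^ ρ := by positivity
  have hcell : ∀ (r : ℝ) (a : ℤ), ⌊(2 : ℝ) ^ ρ * r⌋ = a ↔
      ((2 : ℝ) ^ ρ)⁻¹ * a ≤ r ∧ r < ((2 : ℝ) ^ ρ)⁻¹ * (a + 1) := by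
    intro r a
    rw [Int.floor_eq_iff, inv_mul_le_iff₀ h2, lt_inv_mul_iff₀ h2]
  -- Causality: the noiseless signal at time `t` depends only on readings before `t`. Hence the
  -- condition on `z (v, t)` is an interval condition, and the converse follows by induction on
  -- time.
  have hrec : ∀ v t, (∀ (u : V) (s : Fin n), s < t → C.readings w ρ z (u, s) = x (u, s)) →
      C.received w z v t = C.signalOf w ρ x (v, t) + z (v, t) := by
    intro v t hs
    rw [received_eq, signalOf]
    congr 1
    refine Finset.sum_congr rfl fun u _ => ?_
    rw [hC.transmit_eq]
    congr 2
    funext s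
    have := hs u (Fin.castLE t.isLt.le s) (by simp [Fin.lt_def])
    simp only [pastOf, truncate, ← this, readings]
  constructor
  · rintro rfl ⟨v, t⟩
    have h1 := hrec v t fun _ _ _ => rfl
    have h3 := (hcell (C.received w z v t) _).1 rfl
    rw [h1] at h3
    have h4 : C.readings w ρ z (v, t) = ⌊(2 : ℝ) ^ ρ * (C.signalOf w ρ (C.readings w ρ z) (v, t)
      + z (v, t))⌋ := by rw [← h1]; rfl
    rw [← h4] at h3
    constructor <;> linarith [h3.1, h3.2]
  · intro hz
    have key : ∀ (t : ℕ) (ht : t < n) (v : V),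
        C.readings w ρ z (v, ⟨t, ht⟩) = x (v, ⟨t, ht⟩) := by
      intro t
      induction t using Nat.strong_induction_on with
      | _ t ih =>
        intro ht v
        have h1 := hrec v ⟨t, ht⟩ fun u s hs => ih s hs s.isLt u
        have h3 := hz (v, ⟨t, ht⟩)
        change ⌊(2 : ℝ) ^ ρ * C.received w z v ⟨t, ht⟩⌋ = _
        rw [h1, hcell]
        constructor <;> linarith [h3.1, h3.2]
    funext p
    exact key p.2 p.2.isLt p.1

lemma HasReadingPrecision.readings_preimage_singleton [Fintype V] {C : CodingScheme N P n R}
    {ρ : ℕ} (hC : C.HasReadingPrecision ρ) (w : (i : Fin L) → MessageSet n (R i))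
    (x : V × Fin n → ℤ) :
    C.readings w ρ ⁻¹' {x} = Set.univ.pi fun p =>
      Set.Ico (((2 : ℝ) ^ ρ)⁻¹ * x p - C.signalOf w ρ x p)
        (((2 : ℝ) ^ ρ)⁻¹ * (x p + 1) - C.signalOf w ρ x p) := by
  ext z
  simp only [Set.mem_preimage, Set.mem_singleton_iff, hC.readings_eq_iff, Set.mem_univ_pi]

lemma HasReadingPrecision.measurable_readings [Fintype V] {C : CodingScheme N P n R}
    {ρ : ℕ} (hC : C.HasReadingPrecision ρ) (w : (i : Fin L) → MessageSet n (R i)) :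
    Measurable (C.readings w ρ) := by
  refine measurable_to_countable' fun x => ?_
  rw [hC.readings_preimage_singleton]
  exact MeasurableSet.univ_pi fun _ => measurableSet_Ico

/-- Decoders see only the readings, which take countably many values; the error set is thus a
countable union of boxes. -/
lemma HasReadingPrecision.exists_errorSet_eq [Fintype V] {C : CodingScheme N P n R}
    {ρ : ℕ} (hC : C.HasReadingPrecision ρ) (w : (i : Fin L) → MessageSet n (R i)) :
    ∃ S : Set (V × Fin n → ℤ), C.errorSet w = C.readings w ρ ⁻¹' S := by
  refine ⟨{x | ∃ i, w i ≠ C.dec i fun t => ((2 : ℝ) ^ ρ)⁻¹ * (x (N.dst i, t) : ℝ)}, ?_⟩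
  ext z
  simp only [errorSet, Set.mem_ofPred_eq, Set.mem_preimage]
  refine exists_congr fun i => ?_
  rw [hC.2]
  rfl

lemma HasReadingPrecision.measurableSet_errorSet [Fintype V] {C : CodingScheme N P n R}
    {ρ : ℕ} (hC : C.HasReadingPrecision ρ) (w : (i : Fin L) → MessageSet n (R i)) :
    MeasurableSet (C.errorSet w) := by
  obtain ⟨S, hS⟩ := hC.exists_errorSet_eq w
  rw [hS]
  exact hC.measurable_readings w (Set.to_countable S).measurableSet

end CodingScheme

/-! ### Continuity of the error probability in the noise laws -/

/-- Probability measures on a countable space that converge on singletons converge on all sets. -/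
lemma tendsto_measure_of_tendsto_singleton {T : Type*} [Countable T] [MeasurableSpace T]
    [MeasurableSingletonClass T] {μ : ℕ → Measure T} {μ₀ : Measure T}
    [∀ i, IsProbabilityMeasure (μ i)] [IsProbabilityMeasure μ₀]
    (h : ∀ x, Tendsto (fun i => μ i {x}) atTop (𝓝 (μ₀ {x}))) (S : Set T) :
    Tendsto (fun i => μ i S) atTop (𝓝 (μ₀ S)) := by
  -- Fatou's lemma for sums. Applied to `Sᶜ`, with total mass one, it also bounds the limsup on `S`.
  have hlow : ∀ U : Set T, μ₀ U ≤ atTop.liminf fun i => μ i U := by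
    intro U
    have hsum : ∀ ν : Measure T, ν U = ∑' x : U, ν {(x : T)} := fun ν => by
      rw [← Measure.tsum_indicator_apply_singleton ν U (Set.to_countable U).measurableSet,
        tsum_subtype U (fun x => ν {x})]
    rw [hsum μ₀, ENNReal.tsum_eq_iSup_sum]
    refine iSup_le fun F => ?_
    have h1 : Tendsto (fun i => ∑ x ∈ F, μ i {(x : T)}) atTop (𝓝 (∑ x ∈ F, μ₀ {(x : T)})) :=
      tendsto_finsetSum _ fun x _ => h x
    rw [← h1.liminf_eq]
    refine liminf_le_liminf (Eventually.of_forall fun i => ?_)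
    rw [hsum (μ i)]
    exact ENNReal.sum_le_tsum F
  exact tendsto_of_le_liminf_of_limsup_le (hlow S)
    (limsup_measure_le_of_le_liminf_measure_compl (Set.to_countable S).measurableSet (hlow Sᶜ))

/-- For a scheme of finite reading precision, the error probability is continuous in the noise laws
with respect to convergence on half-open intervals. -/
theorem CodingScheme.HasReadingPrecision.tendsto_errorProb {V : Type*} [Fintype V] {L : ℕ}
    {N : UnicastNetwork V L} {P : ℝ} {n : ℕ} {R : Fin L → ℝ} {C : CodingScheme N P n R} {ρ : ℕ}
    (hC : C.HasReadingPrecision ρ) {κ : ℕ → V → Measure ℝ} {γ : V → Measure ℝ}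
    (hκ : ∀ i v, IsProbabilityMeasure (κ i v)) (hγ : ∀ v, IsProbabilityMeasure (γ v))
    (h : ∀ v x y, Tendsto (fun i => κ i v (Set.Ico x y)) atTop (𝓝 (γ v (Set.Ico x y)))) :
    Tendsto (fun i => C.errorProb (κ i)) atTop (𝓝 (C.errorProb γ)) := by
  unfold errorProb
  refine Tendsto.div_const (tendsto_finsetSum _ fun w _ => ?_) _
  have hm := hC.measurable_readings w
  obtain ⟨S, hS⟩ := hC.exists_errorSet_eq w
  have : ∀ i, IsProbabilityMeasure (noiseLaw (κ i) n) := fun i => by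
    unfold noiseLaw; infer_instance
  have : IsProbabilityMeasure (noiseLaw γ n) := by unfold noiseLaw; infer_instance
  have : ∀ i, IsProbabilityMeasure ((noiseLaw (κ i) n).map (C.readings w ρ)) := fun i =>
    Measure.isProbabilityMeasure_map hm.aemeasurable
  have : IsProbabilityMeasure ((noiseLaw γ n).map (C.readings w ρ)) :=
    Measure.isProbabilityMeasure_map hm.aemeasurable
  -- The mass of a single reading is a finite product of probabilities of half-open intervals.
  have hlim := tendsto_measure_of_tendsto_singleton
    (μ := fun i => (noiseLaw (κ i) n).map (C.readings w ρ))
    (μ₀ := (noiseLaw γ n).map (C.readings w ρ)) (fun x => by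
      simp only [Measure.map_apply hm (measurableSet_singleton x),
        hC.readings_preimage_singleton, noiseLaw, Measure.pi_pi]
      exact ENNReal.tendsto_finsetProd_of_ne_top _ (fun p _ => h _ _ _)
        fun p _ => measure_ne_top _ _) S
  simp only [Measure.map_apply hm (Set.to_countable S).measurableSet, ← hS] at hlim
  exact (ENNReal.tendsto_toReal (measure_ne_top _ _)).comp hlim

/-! ### Central limit theorem for signed averages -/

/-- The law of `b ^ (-1/2) * ∑ j, s j * Z j` for independent `Z j` of law `ν`. -/
noncomputable def mixLaw {b : ℕ} (ν : Measure ℝ) (s : Fin b → ℝ) : Measure ℝ :=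
  (Measure.pi fun _ : Fin b => ν).map fun z => ∑ j, (√b)⁻¹ * s j * z j

lemma measurable_mix {b : ℕ} (s : Fin b → ℝ) :
    Measurable fun z : Fin b → ℝ => ∑ j, (√b)⁻¹ * s j * z j := by fun_prop

instance {b : ℕ} (ν : Measure ℝ) [IsProbabilityMeasure ν] (s : Fin b → ℝ) :
    IsProbabilityMeasure (mixLaw ν s) :=
  Measure.isProbabilityMeasure_map (measurable_mix s).aemeasurable

lemma charFun_mixLaw {b : ℕ} (ν : Measure ℝ) [IsProbabilityMeasure ν] (s : Fin b → ℝ) (t : ℝ) :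
    charFun (mixLaw ν s) t = ∏ j, charFun ν ((√b)⁻¹ * s j * t) := by
  have hind : iIndepFun (fun (j : Fin b) (z : Fin b → ℝ) => (√b)⁻¹ * s j * z j)
      (Measure.pi fun _ : Fin b => ν) :=
    iIndepFun_pi (X := fun j x => (√b)⁻¹ * s j * x)
      fun j => (measurable_id.const_mul _).aemeasurable
  rw [mixLaw, hind.charFun_map_fun_sum_eq_prod
    fun j => ((measurable_pi_apply j).const_mul _).aemeasurable, Finset.prod_apply]
  refine Finset.prod_congr rfl fun j _ => ?_
  rw [charFun_map_mul_comp (measurable_pi_apply j).aemeasurable, (measurePreserving_eval _ j).map_eq]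

lemma norm_prod_sub_prod_le {ι : Type*} (F : Finset ι) (a c : ι → ℂ) (ha : ∀ i, ‖a i‖ ≤ 1)
    (hc : ∀ i, ‖c i‖ ≤ 1) : ‖∏ i ∈ F, a i - ∏ i ∈ F, c i‖ ≤ ∑ i ∈ F, ‖a i - c i‖ := by
  classical
  induction F using Finset.induction_on with
  | empty => simp
  | insert i F hi ih =>
    rw [Finset.prod_insert hi, Finset.prod_insert hi, Finset.sum_insert hi]
    have h1 : ‖∏ i ∈ F, c i‖ ≤ 1 := by
      rw [norm_prod]
      exact Finset.prod_le_one (fun _ _ => norm_nonneg _) fun j _ => hc j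
    calc ‖a i * ∏ i ∈ F, a i - c i * ∏ i ∈ F, c i‖
        = ‖a i * (∏ i ∈ F, a i - ∏ i ∈ F, c i) + (a i - c i) * ∏ i ∈ F, c i‖ := by ring_nf
      _ ≤ ‖a i‖ * ‖∏ i ∈ F, a i - ∏ i ∈ F, c i‖ + ‖a i - c i‖ * ‖∏ i ∈ F, c i‖ := by
          refine (norm_add_le _ _).trans ?_
          rw [norm_mul, norm_mul]
      _ ≤ 1 * ‖∏ i ∈ F, a i - ∏ i ∈ F, c i‖ + ‖a i - c i‖ * 1 := by
          gcongr
          exact ha i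
      _ ≤ _ := by rw [one_mul, mul_one]; linarith

/-- Equal mean and variance give both characteristic functions the second-order Taylor polynomial `1
- σ t² / 2` at `0`. -/
lemma charFun_isLittleO {ν : Measure ℝ} {σ : ℝ≥0} (h : IsNoiseLaw ν σ) :
    (fun t => charFun ν t - charFun (gaussianReal 0 σ) t) =o[𝓝 0] fun t => t ^ 2 := by
  have hp := h.isProbabilityMeasure
  have key : ∀ (μ : Measure ℝ) [IsProbabilityMeasure μ], MemLp id 2 μ → ∫ x, x ∂μ = 0 →
      ∫ x, x ^ 2 ∂μ = σ → (fun t : ℝ => charFun μ t - (1 - (σ : ℂ) * t ^ 2 / 2))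
        =o[𝓝 0] fun t => t ^ 2 := by
    intro μ _ h1 h2 h3
    have heq : ∀ t : ℝ, (1 - (σ : ℂ) * t ^ 2 / 2) =
        taylorWithinEval (charFun μ) 2 Set.univ 0 t := by
      intro t
      have := taylorWithinEval_charFun_two_zero (P := μ) (X := id) (by fun_prop)
        (by simpa using h1) t
      simp only [Measure.map_id] at this
      rw [this]
      have h2' : ∫ x, id x ∂μ = 0 := h2
      have h3' : ∫ x, (id ^ 2 : ℝ → ℝ) x ∂μ = σ := h3
      rw [h2', h3']
      simp
    simp_rw [heq]
    convert! taylor_isLittleO_univ ?_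
    · simp
    · exact contDiff_charFun h1
  have hg := key (gaussianReal 0 σ) (memLp_id_gaussianReal 2) integral_id_gaussianReal (by
    have := variance_id_gaussianReal (μ := 0) (v := σ)
    rw [variance_eq_integral (by fun_prop)] at this
    simpa [integral_id_gaussianReal] using this)
  have hn := key ν h.memLp h.mean_eq_zero h.second_moment_eq
  simpa using hn.sub hg

/-- The Gaussian is stable, so its characteristic function at `t` is also a product of `b` values at
`±t/√b`. The two products differ by at most `b` terms of size `o(t²/b)`. Only the squares of the
signs matter, so these may change arbitrarily with `i`. -/
lemma tendsto_charFun_mixLaw {ν : Measure ℝ} {σ : ℝ≥0} (h : IsNoiseLaw ν σ) {b : ℕ → ℕ}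
    (hb : Tendsto b atTop atTop) (s : (i : ℕ) → Fin (b i) → ℝ) (hs : ∀ i j, |s i j| = 1) (t : ℝ) :
    Tendsto (fun i => charFun (mixLaw ν (s i)) t) atTop (𝓝 (charFun (gaussianReal 0 σ) t)) := by
  have hp := h.isProbabilityMeasure
  have hs2 : ∀ i j, s i j ^ 2 = 1 := fun i j => by rw [← sq_abs, hs, one_pow]
  have hgauss : ∀ᶠ i in atTop, charFun (gaussianReal 0 σ) t =
      ∏ j, charFun (gaussianReal 0 σ) ((√(b i))⁻¹ * s i j * t) := by
    filter_upwards [hb.eventually_gt_atTop 0] with i hi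
    simp only [charFun_gaussianReal, ← Complex.exp_sum]
    congr 1
    have hbi : (b i : ℂ) ≠ 0 := by exact_mod_cast hi.ne'
    have : ∀ j, ((((√(b i))⁻¹ * s i j * t : ℝ) : ℂ)) ^ 2 = (b i : ℂ)⁻¹ * (t : ℂ) ^ 2 := by
      intro j
      rw [← Complex.ofReal_pow, mul_pow, mul_pow, hs2, inv_pow, Real.sq_sqrt (by positivity)]
      push_cast
      ring
    simp only [this]
    simp
    field_simp
  rw [tendsto_iff_norm_sub_tendsto_zero]
  refine squeeze_zero' (Eventually.of_forall fun _ => norm_nonneg _) (g := fun i => ∑ j,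
    ‖charFun ν ((√(b i))⁻¹ * s i j * t) -
      charFun (gaussianReal 0 σ) ((√(b i))⁻¹ * s i j * t)‖) ?_ ?_
  · filter_upwards [hgauss] with i hi
    rw [hi, charFun_mixLaw]
    exact norm_prod_sub_prod_le _ _ _ (fun _ => norm_charFun_le_one _) fun _ =>
      norm_charFun_le_one _
  · rw [Metric.tendsto_atTop']
    intro ε hε
    -- The `+ 1` covers `t = 0` and makes the final inequality strict.
    have hc : 0 < ε / (t ^ 2 + 1) := by positivity
    have ho := (charFun_isLittleO h).def hc
    rw [Metric.eventually_nhds_iff] at ho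
    obtain ⟨r, hr, ho⟩ := ho
    have hsm : Tendsto (fun i => (√(b i : ℝ))⁻¹ * |t|) atTop (𝓝 0) := by
      rw [← zero_mul |t|]
      exact (tendsto_inv_atTop_zero.comp (Real.tendsto_sqrt_atTop.comp
        (tendsto_natCast_atTop_atTop.comp hb))).mul_const _
    obtain ⟨i0, hi0⟩ := eventually_atTop.1 ((hsm.eventually_lt_const hr).and
      (hb.eventually_gt_atTop 0))
    refine ⟨i0, fun i hi => ?_⟩
    obtain ⟨h1, h2⟩ := hi0 i hi.le
    have hbi : (0 : ℝ) < b i := by exact_mod_cast h2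
    have hterm : ∀ j, ‖charFun ν ((√(b i))⁻¹ * s i j * t) -
        charFun (gaussianReal 0 σ) ((√(b i))⁻¹ * s i j * t)‖ ≤
          ε / (t ^ 2 + 1) * ((b i : ℝ)⁻¹ * t ^ 2) := by
      intro j
      have h3 := @ho ((√(b i))⁻¹ * s i j * t) (by
        rw [Real.dist_eq, sub_zero, abs_mul, abs_mul, hs, mul_one, abs_of_nonneg (by positivity)]
        exact h1)
      rwa [Real.norm_of_nonneg (by positivity), mul_pow, mul_pow, hs2, inv_pow,
        Real.sq_sqrt hbi.le, mul_one] at h3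
    rw [Real.dist_eq, sub_zero, abs_of_nonneg (Finset.sum_nonneg fun _ _ => norm_nonneg _)]
    calc _ ≤ ∑ _j : Fin (b i), ε / (t ^ 2 + 1) * ((b i : ℝ)⁻¹ * t ^ 2) :=
          Finset.sum_le_sum fun j _ => hterm j
      _ = ε * (t ^ 2 / (t ^ 2 + 1)) := by simp; field_simp
      _ < ε * 1 := by
          gcongr
          rw [div_lt_one (by positivity)]
          linarith
      _ = ε := mul_one ε

lemma IsNoiseLaw.eq_dirac {ν : Measure ℝ} (h : IsNoiseLaw ν 0) : ν = Measure.dirac 0 := by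
  have hp := h.isProbabilityMeasure
  have h2 : ∫ x, x ^ 2 ∂ν = 0 := by simpa using h.second_moment_eq
  rw [integral_eq_zero_iff_of_nonneg (fun x => sq_nonneg x) h.memLp.integrable_sq] at h2
  have h3 : (id : ℝ → ℝ) =ᵐ[ν] fun _ => 0 := by
    filter_upwards [h2] with x hx
    simpa using hx
  rw [← Measure.map_id (μ := ν), Measure.map_congr h3, Measure.map_const]
  simp

lemma mixLaw_dirac {b : ℕ} (s : Fin b → ℝ) : mixLaw (Measure.dirac 0) s = Measure.dirac 0 := by
  refine Measure.ext_of_charFun (funext fun t => ?_)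
  rw [charFun_mixLaw]
  simp

/-- A central limit theorem for sums with arbitrary signs, on half-open intervals. -/
lemma tendsto_mixLaw_Ico {ν : Measure ℝ} {σ : ℝ≥0} (h : IsNoiseLaw ν σ) {b : ℕ → ℕ}
    (hb : Tendsto b atTop atTop) (s : (i : ℕ) → Fin (b i) → ℝ) (hs : ∀ i j, |s i j| = 1)
    (x y : ℝ) :
    Tendsto (fun i => mixLaw ν (s i) (Set.Ico x y)) atTop
      (𝓝 (gaussianReal 0 σ (Set.Ico x y))) := by
  have hp := h.isProbabilityMeasure
  -- With zero variance the limit is a point mass, possibly at an endpoint of the interval, so weak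
  -- convergence would not suffice; but then both laws are that point mass.
  rcases eq_or_ne σ 0 with rfl | hσ
  · rw [h.eq_dirac]
    simp only [mixLaw_dirac, gaussianReal_zero_var]
    exact tendsto_const_nhds
  · have hlim : Tendsto (β := ProbabilityMeasure ℝ) (fun i => ⟨mixLaw ν (s i), inferInstance⟩) atTop
        (𝓝 ⟨gaussianReal 0 σ, inferInstance⟩) :=
      ProbabilityMeasure.tendsto_of_tendsto_charFun fun t => tendsto_charFun_mixLaw h hb s hs t
    refine ProbabilityMeasure.tendsto_measure_of_null_frontier_of_tendsto' hlim ?_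
    have : NullSingletonClass (gaussianReal 0 σ) :=
      nullSingletonClass_gaussianReal hσ
    refine measure_mono_null (t := {x, y}) ?_ ?_
    rcases lt_or_ge x y with hxy | hxy
    · rw [frontier_Ico hxy]
    · simp [Set.Ico_eq_empty (not_lt.2 hxy)]
    · exact Set.Countable.measure_zero (by simp) (gaussianReal 0 σ)

/-- Under any noise laws, the error probability of a scheme of finite reading precision with signed
averages of many noise variables is close to the one under Gaussian noise, uniformly in the
signs. -/
theorem CodingScheme.HasReadingPrecision.exists_forall_errorProb_mixLaw_lt {V : Type*} [Fintype V]
    {L : ℕ} {N : UnicastNetwork V L} {P : ℝ} {n : ℕ} {R : Fin L → ℝ} {C : CodingScheme N P n R}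
    {ρ : ℕ} (hC : C.HasReadingPrecision ρ) {σsq : V → ℝ≥0} {δ : ℝ}
    (hδ : C.errorProb (awgn σsq) < δ) {ν : V → Measure ℝ} (hν : ∀ v, IsNoiseLaw (ν v) (σsq v)) :
    ∃ b₀ : ℕ, ∀ b ≥ b₀, ∀ s : Fin b → ℝ, (∀ j, |s j| = 1) →
      C.errorProb (fun v => mixLaw (ν v) s) < δ := by
  -- Uniformity in the signs by contradiction: failures for arbitrarily large `b` form a sequence of
  -- sign vectors, to which the limit theorem with varying signs applies.
  by_contra! hcon
  choose b hb s hs hbad using hcon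
  have hbt : Tendsto b atTop atTop := tendsto_atTop_mono hb tendsto_id
  have hp := fun v => (hν v).isProbabilityMeasure
  have hlim := hC.tendsto_errorProb (κ := fun i v => mixLaw (ν v) (s i)) (γ := awgn σsq)
    (fun i v => inferInstance) (fun v => by unfold awgn; infer_instance)
    (fun v x y => tendsto_mixLaw_Ico (hν v) hbt s hs x y)
  exact absurd (ge_of_tendsto' hlim hbad) (not_le.2 hδ)

/-! ### Random binary linear codes -/

section LinearCode

lemma card_fiber_mul_card {X Y : Type*} [AddGroup X] [AddGroup Y] [Fintype X] [Fintype Y]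
    [DecidableEq Y] (φ : X →+ Y) (hφ : Function.Surjective φ) (y : Y) :
    (Finset.univ.filter fun x => φ x = y).card * Fintype.card Y = Fintype.card X := by
  have h := Finset.card_eq_sum_card_fiberwise (s := (Finset.univ : Finset X))
    (t := (Finset.univ : Finset Y)) (f := φ) (fun _ _ => Finset.mem_coe.2 (Finset.mem_univ _))
  have hc : ∀ y' ∈ (Finset.univ : Finset Y), (Finset.univ.filter fun x => φ x = y').card =
      (Finset.univ.filter fun x => φ x = y).card := fun y' _ =>
    AddMonoidHom.card_fiber_eq_of_mem_range φ (hφ y') (hφ y)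
  rw [Finset.sum_congr rfl hc] at h
  simp only [Finset.sum_const, smul_eq_mul, Finset.card_univ] at h
  rw [h, mul_comm]

/-- The image of the uniform law under a surjective homomorphism is uniform. -/
lemma sum_comp_mul_card {X Y : Type*} [AddGroup X] [AddGroup Y] [Fintype X] [Fintype Y]
    (φ : X →+ Y) (hφ : Function.Surjective φ) (f : Y → ℝ) :
    (∑ x, f (φ x)) * Fintype.card Y = Fintype.card X * ∑ y, f y := by
  classical
  rw [← Finset.sum_fiberwise (s := (Finset.univ : Finset X)) (g := φ), Finset.sum_mul,
    Finset.mul_sum]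
  refine Finset.sum_congr rfl fun y _ => ?_
  rw [Finset.sum_congr rfl (g := fun _ => f y) (fun x hx => by rw [(Finset.mem_filter.1 hx).2]),
    Finset.sum_const, nsmul_eq_mul, ← card_fiber_mul_card φ hφ y]
  push_cast
  ring

/-- Choose a set of at most `d` positions containing the support (at most `2 ^ |J|` ways), then the
values on it. -/
lemma card_hammingNorm_le {J S : Type*} [Fintype J] [DecidableEq J] [Fintype S] [DecidableEq S]
    [Zero S] (d : ℕ) :
    (Finset.univ.filter fun y : J → S => hammingNorm y ≤ d).card ≤
      2 ^ Fintype.card J * Fintype.card S ^ d := by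
  have hsub : (Finset.univ.filter fun y : J → S => hammingNorm y ≤ d) ⊆
      ((Finset.univ : Finset (Finset J)).filter fun T => T.card ≤ d).biUnion fun T =>
        Fintype.piFinset fun j => if j ∈ T then Finset.univ else {0} := by
    intro y hy
    rw [Finset.mem_biUnion]
    refine ⟨Finset.univ.filter fun j => y j ≠ 0, by simpa [hammingNorm] using hy, ?_⟩
    rw [Fintype.mem_piFinset]
    intro j
    by_cases hj : y j = 0 <;> simp [hj]
  refine (Finset.card_le_card hsub).trans (Finset.card_biUnion_le.trans ?_)
  refine (Finset.sum_le_card_nsmul _ _ (Fintype.card S ^ d) fun T hT => ?_).trans ?_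
  · rw [Fintype.card_piFinset]
    have : ∀ j, (if j ∈ T then (Finset.univ : Finset S) else {0}).card =
        if j ∈ T then Fintype.card S else 1 := by
      intro j
      split_ifs <;> simp
    simp only [this, Finset.prod_ite_mem, Finset.univ_inter, Finset.prod_const]
    exact Nat.pow_le_pow_right (Fintype.card_pos_iff.2 ⟨0⟩) (Finset.mem_filter.1 hT).2
  · rw [smul_eq_mul]
    gcongr
    refine (Finset.card_filter_le _ _).trans ?_
    simp

variable {J : Type*} [Fintype J] [DecidableEq J] {a K : ℕ}

/-- Some coordinate of `x` is `1`, so varying that row of `G` alone reaches every `y`: the codeword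
of `x` is uniform for uniform `G`. -/
lemma card_linearCombination_eq (x : Fin K → ZMod 2) (hx : x ≠ 0) (y : J → Fin a → ZMod 2) :
    (Finset.univ.filter fun G : Fin K → J → Fin a → ZMod 2 =>
      Fintype.linearCombination (ZMod 2) G x = y).card * 2 ^ (a * Fintype.card J) =
      Fintype.card (Fin K → J → Fin a → ZMod 2) := by
  obtain ⟨i, hi⟩ := Function.ne_iff.1 hx
  have hi1 : x i = 1 := by
    have : ∀ r : ZMod 2, r ≠ 0 → r = 1 := by decide
    exact this _ hi
  let φ : (Fin K → J → Fin a → ZMod 2) →+ (J → Fin a → ZMod 2) :=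
    { toFun := fun G => Fintype.linearCombination (ZMod 2) G x
      map_zero' := by simp [Fintype.linearCombination_apply]
      map_add' := fun G G' => by
        simp [Fintype.linearCombination_apply, Finset.sum_add_distrib] }
  have hφ : Function.Surjective φ := by
    intro y
    refine ⟨Pi.single i y, ?_⟩
    change Fintype.linearCombination (ZMod 2) (Pi.single i y) x = y
    rw [Fintype.linearCombination_apply, Finset.sum_eq_single i]
    · simp [hi1]
    · intro j _ hj
      simp [hj]
    · simp
  have h := card_fiber_mul_card φ hφ y
  have hY : Fintype.card (J → Fin a → ZMod 2) = 2 ^ (a * Fintype.card J) := by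
    simp [ZMod.card, pow_mul]
  rw [hY] at h
  exact h

/-- For uniform `G` the `K` bits `f (G i)` are jointly uniform. -/
lemma card_forall_dual_eq_zero (f : Module.Dual (ZMod 2) (J → Fin a → ZMod 2)) (hf : f ≠ 0) :
    (Finset.univ.filter fun G : Fin K → J → Fin a → ZMod 2 => ∀ i, f (G i) = 0).card * 2 ^ K =
      Fintype.card (Fin K → J → Fin a → ZMod 2) := by
  let φ : (Fin K → J → Fin a → ZMod 2) →+ (Fin K → ZMod 2) :=
    { toFun := fun G i => f (G i)
      map_zero' := by funext i; simp
      map_add' := fun G G' => by funext i; simp }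
  have hφ : Function.Surjective φ := by
    intro y
    choose G hG using fun i => LinearMap.surjective hf (y i)
    exact ⟨G, funext hG⟩
  have h := card_fiber_mul_card φ hφ 0
  have hY : Fintype.card (Fin K → ZMod 2) = 2 ^ K := by simp [ZMod.card]
  rw [hY] at h
  rw [← h]
  congr 2
  ext G
  simp [φ, funext_iff]

/-- Existence of binary linear codes over blocks of `a` bits, with large minimum distance and with
pairwise independent symbols. -/
theorem exists_linear_code (J : Type*) [Fintype J] [DecidableEq J] (a K e : ℕ)
    (h : (a = 0 ∧ K = 0) ∨ (K + Fintype.card J + 2 * a * e + 2 ≤ a * Fintype.card J ∧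
      2 * Fintype.card J + 2 * a + 2 ≤ K)) :
    ∃ c : (Fin K → ZMod 2) →ₗ[ZMod 2] (J → Fin a → ZMod 2),
      (∀ x ≠ 0, 2 * e < hammingNorm (c x)) ∧
      ∀ j j', j ≠ j' → Function.Surjective fun x => (c x j, c x j') := by
  classical
  rcases h with ⟨rfl, rfl⟩ | ⟨h1, h2⟩
  · exact ⟨0, fun x hx => (hx (Subsingleton.elim _ _)).elim,
      fun j j' _ y => ⟨0, Subsingleton.elim _ _⟩⟩
  -- Union bound over generator matrices `G`. `A` collects those sending some nonzero message to
  -- weight at most `2 e`; `B` those for which a functional of two symbols, not identically zero,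
  -- vanishes on all rows, as it must when surjectivity fails. Each has at most a quarter of all
  -- `G`, yet together they would cover everything.
  by_contra hcon
  set 𝒢 := Fin K → J → Fin a → ZMod 2
  let S := Fin a → ZMod 2
  let D := Module.Dual (ZMod 2) (S × S)
  have hDcard : Nat.card D = 2 ^ (2 * a) := by
    rw [Module.natCard_eq_pow_finrank (K := ZMod 2), Subspace.dual_finrank_eq]
    simp [S, two_mul]
  have : Finite D := Nat.finite_of_card_ne_zero (by rw [hDcard]; positivity)
  have : Fintype D := Fintype.ofFinite D
  let pr : J × J → ((J → S) →ₗ[ZMod 2] S × S) := fun p =>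
    (LinearMap.proj p.1).prod (LinearMap.proj p.2)
  let A := ((Finset.univ : Finset (Fin K → ZMod 2)).filter (· ≠ 0) ×ˢ
    (Finset.univ.filter fun y : J → S => hammingNorm y ≤ 2 * e)).biUnion fun p =>
      Finset.univ.filter fun G : 𝒢 => Fintype.linearCombination (ZMod 2) G p.1 = p.2
  let B := ((Finset.univ : Finset ((J × J) × D)).filter fun p => p.2 ∘ₗ pr p.1 ≠ 0).biUnion
    fun p => Finset.univ.filter fun G : 𝒢 => ∀ i, (p.2 ∘ₗ pr p.1) (G i) = 0
  have hcover : (Finset.univ : Finset 𝒢) ⊆ A ∪ B := by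
    intro G _
    rw [Finset.mem_union]
    by_contra! hG
    refine hcon ⟨Fintype.linearCombination (ZMod 2) G, fun x hx => ?_, fun j j' hj => ?_⟩
    · by_contra! hle
      refine hG.1 (Finset.mem_biUnion.2 ⟨(x, Fintype.linearCombination (ZMod 2) G x), ?_, ?_⟩)
      · simp [hx, hle]
      · simp
    · have hsurj : Function.Surjective (pr (j, j')) := by
        rintro ⟨y, y'⟩
        refine ⟨Function.update (fun _ => y') j y, ?_⟩
        simp [pr, hj.symm]
      by_contra hns
      have hlt : LinearMap.range (pr (j, j') ∘ₗ Fintype.linearCombination (ZMod 2) G) < ⊤ := by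
        rw [lt_top_iff_ne_top]
        intro htop
        exact hns (LinearMap.range_eq_top.1 htop)
      obtain ⟨f, hf, hle⟩ := Submodule.exists_le_ker_of_lt_top _ hlt
      refine hG.2 (Finset.mem_biUnion.2 ⟨((j, j'), f), ?_, ?_⟩)
      · rw [Finset.mem_filter]
        refine ⟨Finset.mem_univ _, fun h0 => hf ?_⟩
        refine LinearMap.ext fun y => ?_
        obtain ⟨y, rfl⟩ := hsurj y
        exact LinearMap.congr_fun h0 y
      · rw [Finset.mem_filter]
        refine ⟨Finset.mem_univ _, fun i => ?_⟩
        have : pr (j, j') (G i) ∈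
            LinearMap.range (pr (j, j') ∘ₗ Fintype.linearCombination (ZMod 2) G) :=
          ⟨Pi.single i 1, by simp⟩
        exact hle this
  have hA : 4 * A.card ≤ Fintype.card 𝒢 := by
    have hle : A.card * 2 ^ (a * Fintype.card J) ≤
        (2 ^ K * (2 ^ Fintype.card J * (2 ^ a) ^ (2 * e))) * Fintype.card 𝒢 := by
      refine (Nat.mul_le_mul_right _ Finset.card_biUnion_le).trans ?_
      rw [Finset.sum_mul]
      refine (Finset.sum_le_card_nsmul _ _ (Fintype.card 𝒢) fun p hp => ?_).trans ?_
      · rw [Finset.mem_product, Finset.mem_filter] at hp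
        exact (card_linearCombination_eq p.1 hp.1.2 p.2).le
      · rw [smul_eq_mul, Finset.card_product]
        gcongr
        · refine (Finset.card_filter_le _ _).trans ?_
          simp [ZMod.card]
        · refine (card_hammingNorm_le (J := J) (S := S) (2 * e)).trans ?_
          simp [S, ZMod.card]
    have hpow : 4 * (2 ^ K * (2 ^ Fintype.card J * (2 ^ a) ^ (2 * e))) ≤
        2 ^ (a * Fintype.card J) := by
      rw [← pow_mul, ← pow_add, ← pow_add, show (4 : ℕ) = 2 ^ 2 by norm_num, ← pow_add]
      refine Nat.pow_le_pow_right (by norm_num) ?_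
      linarith
    refine Nat.le_of_mul_le_mul_left (c := 2 ^ K * (2 ^ Fintype.card J * (2 ^ a) ^ (2 * e))) ?_
      (by positivity)
    nlinarith
  have hB : 4 * B.card ≤ Fintype.card 𝒢 := by
    have hle : B.card * 2 ^ K ≤
        (Fintype.card J * Fintype.card J * 2 ^ (2 * a)) * Fintype.card 𝒢 := by
      refine (Nat.mul_le_mul_right _ Finset.card_biUnion_le).trans ?_
      rw [Finset.sum_mul]
      refine (Finset.sum_le_card_nsmul _ _ (Fintype.card 𝒢) fun p hp => ?_).trans ?_
      · exact (card_forall_dual_eq_zero _ (Finset.mem_filter.1 hp).2).le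
      · rw [smul_eq_mul]
        gcongr
        refine (Finset.card_filter_le _ _).trans ?_
        rw [Finset.card_univ, Fintype.card_prod, Fintype.card_prod, ← Nat.card_eq_fintype_card
          (α := D), hDcard]
    have hpow : 4 * (Fintype.card J * Fintype.card J * 2 ^ (2 * a)) ≤ 2 ^ K := by
      have hJ : Fintype.card J ≤ 2 ^ Fintype.card J := Nat.lt_two_pow_self.le
      calc 4 * (Fintype.card J * Fintype.card J * 2 ^ (2 * a))
          ≤ 4 * (2 ^ Fintype.card J * 2 ^ Fintype.card J * 2 ^ (2 * a)) := by gcongr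
        _ = 2 ^ (2 * Fintype.card J + 2 * a + 2) := by ring
        _ ≤ 2 ^ K := Nat.pow_le_pow_right (by norm_num) h2
    have h3 : B.card * (4 * (Fintype.card J * Fintype.card J * 2 ^ (2 * a))) ≤
      (Fintype.card J * Fintype.card J * 2 ^ (2 * a)) * Fintype.card 𝒢 :=
      (Nat.mul_le_mul_left _ hpow).trans hle
    rcases Nat.eq_zero_or_pos (Fintype.card J) with h0 | h0
    · rw [h0] at hle
      have : B.card = 0 := by simpa using hle
      rw [this]
      simp
    · refine Nat.le_of_mul_le_mul_left
        (c := Fintype.card J * Fintype.card J * 2 ^ (2 * a)) ?_ (by positivity)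
      nlinarith
  have hcard : Fintype.card 𝒢 ≤ A.card + B.card := by
    rw [← Finset.card_univ]
    exact (Finset.card_le_card hcover).trans (Finset.card_union_le _ _)
  have hpos : 0 < Fintype.card 𝒢 := Fintype.card_pos
  omega

end LinearCode

/-! ### Joint law of the noise seen by the inner schemes -/

section Noise

lemma pi_map_curry_of_injective {ι A T : Type*} [Fintype ι] [Fintype A] [Fintype T]
    (μ : ι → Measure ℝ) [∀ i, IsProbabilityMeasure (μ i)] (e : A × T → ι)
    (he : Function.Injective e) :
    (Measure.pi μ).map (fun z (a : A) (c : T) => z (e (a, c))) =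
      Measure.pi fun a => Measure.pi fun c => μ (e (a, c)) := by
  have h1 : (Measure.pi μ).map (fun z (p : A × T) => z (e p)) = Measure.pi fun p => μ (e p) := by
    have := Measure.map_infinitePi_infinitePi_of_inj (P := μ) he
    rwa [Measure.infinitePi_eq_pi, Measure.infinitePi_eq_pi] at this
  have h2 := Measure.infinitePi_map_curry (fun a c => μ (e (a, c)))
  simp only [Measure.infinitePi_eq_pi] at h2
  rw [← h2]
  change _ = (Measure.pi fun p => μ (e p)).map _
  rw [← h1, Measure.map_map (by fun_prop) (by fun_prop)]
  rfl

/-- Distinct triples of group, node and inner time use disjoint noise variables, so independence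
persists. Only one copy `l g` per group is taken, because copies of one group mix the same
variables. -/
lemma map_innerNoise {V : Type*} [Fintype V] {k n b m : ℕ} (h : k * (n * b) ≤ m)
    (H : Fin b → Fin b → ℝ) (ν : V → Measure ℝ) [∀ v, IsProbabilityMeasure (ν v)]
    (l : Fin k → Fin b) :
    (noiseLaw ν m).map (fun z g => CodingScheme.innerNoise h (fun i j => (√b)⁻¹ * H i j) z g (l g)) =
      Measure.pi fun g => noiseLaw (fun v => mixLaw (ν v) (H (l g))) n := by
  have h1 := pi_map_curry_of_injective (fun p : V × Fin m => ν p.1)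
    (fun p : (Fin k × (V × Fin n)) × Fin b => (p.1.2.1, slot h (p.1.1, p.1.2.2, p.2)))
    (by
      rintro ⟨⟨g, v, t⟩, j⟩ ⟨⟨g', v', t'⟩, j'⟩ hp
      simp only [Prod.mk.injEq, (slot_injective h).eq_iff] at hp ⊢
      tauto)
  have h2 := Measure.pi_map_pi (μ := fun a : Fin k × (V × Fin n) =>
      Measure.pi fun _ : Fin b => ν a.2.1)
    (f := fun a y => ∑ j, (√b)⁻¹ * H (l a.1) j * y j) fun a =>
      (Finset.measurable_sum _ fun j _ => (measurable_pi_apply j).const_mul _).aemeasurable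
  rw [← h1, Measure.map_map (by fun_prop) (by fun_prop)] at h2
  have h3 := pi_map_curry_of_injective
    (fun a : Fin k × (V × Fin n) => mixLaw (ν a.2.1) (H (l a.1))) id Function.injective_id
  change Measure.map _ (Measure.pi fun a : Fin k × (V × Fin n) => (Measure.pi fun _ => ν a.2.1).map
    fun y => ∑ j, (√b)⁻¹ * H (l a.1) j * y j) = _ at h3
  rw [← h2, Measure.map_map (by fun_prop) (by fun_prop)] at h3
  exact h3

lemma measurable_innerNoise {V : Type*} {k n b m : ℕ} (h : k * (n * b) ≤ m)
    (Q : Fin b → Fin b → ℝ) (g : Fin k) (l : Fin b) :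
    Measurable fun z : V × Fin m → ℝ => CodingScheme.innerNoise (n := n) h Q z g l := by
  refine measurable_pi_lambda _ fun p => ?_
  unfold CodingScheme.innerNoise
  fun_prop

instance isProbabilityMeasure_noiseLaw {V : Type*} [Fintype V] (ν : V → Measure ℝ)
    [∀ v, IsProbabilityMeasure (ν v)] (n : ℕ) : IsProbabilityMeasure (noiseLaw ν n) := by
  unfold noiseLaw
  infer_instance

lemma measureReal_innerNoise_preimage {V : Type*} [Fintype V] {k n b m : ℕ} (h : k * (n * b) ≤ m)
    (H : Fin b → Fin b → ℝ) (ν : V → Measure ℝ) [∀ v, IsProbabilityMeasure (ν v)]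
    (g : Fin k) (l : Fin b) {A : Set (V × Fin n → ℝ)} (hA : MeasurableSet A) :
    (noiseLaw ν m).real
      ((fun z => CodingScheme.innerNoise h (fun i j => (√b)⁻¹ * H i j) z g l) ⁻¹' A) =
      (noiseLaw (fun v => mixLaw (ν v) (H l)) n).real A := by
  have h1 := map_innerNoise (n := n) h H ν (fun _ => l)
  have h2 := (measurePreserving_eval
    (fun _ : Fin k => noiseLaw (fun v => mixLaw (ν v) (H l)) n) g).map_eq
  rw [← h1, Measure.map_map (measurable_pi_apply g)
    (measurable_pi_lambda _ fun g => measurable_innerNoise h _ g l)] at h2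
  rw [← h2, map_measureReal_apply ((measurable_pi_apply g).comp
    (measurable_pi_lambda _ fun g => measurable_innerNoise h _ g l)) hA]
  rfl

lemma indepFun_innerNoise {V : Type*} [Fintype V] {k n b m : ℕ} (h : k * (n * b) ≤ m)
    (H : Fin b → Fin b → ℝ) (ν : V → Measure ℝ) [∀ v, IsProbabilityMeasure (ν v)]
    {g g' : Fin k} (hg : g ≠ g') (l l' : Fin b) :
    IndepFun
      (fun z => CodingScheme.innerNoise (n := n) h (fun i j => (√b)⁻¹ * H i j) z g l)
      (fun z => CodingScheme.innerNoise (n := n) h (fun i j => (√b)⁻¹ * H i j) z g' l')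
      (noiseLaw ν m) := by
  -- One choice of copies that is `l` in group `g` and `l'` in group `g'`.
  set r : Fin k → Fin b := fun i => if i = g then l else l' with hr
  have hm : ∀ g, Measurable fun z : V × Fin m → ℝ =>
      CodingScheme.innerNoise (n := n) h (fun i j => (√b)⁻¹ * H i j) z g (r g) := fun g =>
    measurable_innerNoise h _ g (r g)
  have hind : iIndepFun (fun g z =>
      CodingScheme.innerNoise (n := n) h (fun i j => (√b)⁻¹ * H i j) z g (r g))
      (noiseLaw ν m) := by
    rw [iIndepFun_iff_map_fun_eq_pi_map fun g => (hm g).aemeasurable, map_innerNoise]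
    congr 1
    funext g
    have h2 := (measurePreserving_eval
      (fun g : Fin k => noiseLaw (fun v => mixLaw (ν v) (H (r g))) n) g).map_eq
    rw [← map_innerNoise (n := n) h H ν r, Measure.map_map (measurable_pi_apply g)
      (measurable_pi_lambda _ hm)] at h2
    exact h2.symm
  have := hind.indepFun hg
  simpa only [hr, if_true, if_neg hg.symm] using this

end Noise

/-! ### Second moment bound for the number of failed copies -/

/-- Second moment bound for the number of bad positions of a random codeword, when positions in
different groups are independent. -/
lemma sum_measureReal_many_bad_le {k b : ℕ} (hk : 0 < k) (hb : 0 < b) {X Y Ω : Type*} [AddGroup X]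
    [AddGroup Y] [Fintype X] [Fintype Y] [MeasurableSpace Ω] (μ : Measure Ω)
    [IsProbabilityMeasure μ] (c : X → Fin k × Fin b → Y)
    (hc : ∀ p q : Fin k × Fin b, p ≠ q →
      ∃ φ : X →+ Y × Y, Function.Surjective φ ∧ ∀ x, φ x = (c x p, c x q))
    (E : Fin k × Fin b → Y → Set Ω) (hE : ∀ p y, MeasurableSet (E p y))
    (hind : ∀ p q : Fin k × Fin b, p.1 ≠ q.1 → ∀ y y',
      μ.real (E p y ∩ E q y') = μ.real (E p y) * μ.real (E q y'))
    {δ θ : ℝ} (hδ : ∀ p, (∑ y, μ.real (E p y)) / Fintype.card Y ≤ δ) (hθ : δ < θ) :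
    (∑ x, μ.real {ω | θ * (k * b) ≤ ∑ p, (E p (c x p)).indicator (fun _ => (1 : ℝ)) ω}) /
      Fintype.card X ≤ 1 / (k * (θ - δ) ^ 2) := by
  classical
  -- Centring uses the average over the symbol `y`, not the probability for each `y`; the centred
  -- probabilities then cancel only after summation over `y`.
  set d : Fin k × Fin b → ℝ := fun p => (∑ y, μ.real (E p y)) / Fintype.card Y with hd
  have hY : (0 : ℝ) < Fintype.card Y := by exact_mod_cast Fintype.card_pos
  have hX : (0 : ℝ) < Fintype.card X := by exact_mod_cast Fintype.card_pos
  have hd0 : ∀ p, 0 ≤ d p := fun p => by positivity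
  have hd1 : ∀ p, d p ≤ 1 := fun p => by
    rw [hd, div_le_one hY]
    refine (Finset.sum_le_card_nsmul _ _ 1 fun y _ => measureReal_le_one).trans ?_
    simp
  let f : Fin k × Fin b → Y → Ω → ℝ := fun p y ω => (E p y).indicator (fun _ => (1 : ℝ)) ω - d p
  have hint1 : ∀ p y, Integrable ((E p y).indicator fun _ => (1 : ℝ)) μ := fun p y =>
    (integrable_const 1).indicator (hE p y)
  have hf_meas : ∀ p y, Measurable (f p y) := fun p y =>
    (measurable_const.indicator (hE p y)).sub_const _
  have hf_abs : ∀ p y ω, |f p y ω| ≤ 1 := by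
    intro p y ω
    have h0 := hd0 p
    have h1 := hd1 p
    simp only [f, Set.indicator_apply]
    split_ifs <;> rw [abs_le] <;> constructor <;> linarith
  have hff_abs : ∀ p q y y' ω, |f p y ω * f q y' ω| ≤ 1 := fun p q y y' ω => by
    rw [abs_mul]
    exact mul_le_one₀ (hf_abs p y ω) (abs_nonneg _) (hf_abs q y' ω)
  have hff_int : ∀ p q y y', Integrable (fun ω => f p y ω * f q y' ω) μ := fun p q y y' =>
    Integrable.of_bound ((hf_meas p y).mul (hf_meas q y')).aestronglyMeasurable 1
      (Eventually.of_forall fun ω => hff_abs p q y y' ω)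
  have hcov : ∀ p q : Fin k × Fin b, p.1 ≠ q.1 → ∀ y y', ∫ ω, f p y ω * f q y' ω ∂μ =
      (μ.real (E p y) - d p) * (μ.real (E q y') - d q) := by
    intro p q hpq y y'
    have hexp : ∀ ω, f p y ω * f q y' ω = (E p y ∩ E q y').indicator (fun _ => (1 : ℝ)) ω
        - d q * (E p y).indicator (fun _ => (1 : ℝ)) ω
        - d p * (E q y').indicator (fun _ => (1 : ℝ)) ω + d p * d q := by
      intro ω
      simp only [f, Set.indicator_apply, Set.mem_inter_iff]
      by_cases h1 : ω ∈ E p y <;> by_cases h2 : ω ∈ E q y' <;> simp [h1, h2] <;> ring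
    have hi : ∀ A : Set Ω, MeasurableSet A → ∫ ω, A.indicator (fun _ => (1 : ℝ)) ω ∂μ = μ.real A :=
      fun A hA => by rw [integral_indicator hA]; simp
    have hint3 : Integrable ((E p y ∩ E q y').indicator fun _ => (1 : ℝ)) μ :=
      (integrable_const 1).indicator ((hE p y).inter (hE q y'))
    simp only [hexp]
    have hi1 := (hint1 p y).const_mul (d q)
    have hi2 := (hint1 q y').const_mul (d p)
    rw [integral_add ?_ (integrable_const _), integral_sub ?_ hi2, integral_sub hint3 hi1,
      integral_const_mul, integral_const_mul, hi _ (hE p y), hi _ (hE q y'),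
      hi _ ((hE p y).inter (hE q y')), hind p q hpq]
    · simp
      ring
    · exact hint3.sub hi1
    · exact (hint3.sub hi1).sub hi2
  have hsum0 : ∀ p, ∑ y, (μ.real (E p y) - d p) = 0 := by
    intro p
    rw [Finset.sum_sub_distrib]
    simp only [hd, Finset.sum_const, Finset.card_univ, nsmul_eq_mul]
    field_simp
    simp
  -- In different groups the noise is independent and the two symbols are jointly uniform, so the
  -- sum factors into two vanishing sums. Within a group the trivial bound `1` is used, for `b`
  -- choices of `q` per `p`.
  have hpair : ∀ p q : Fin k × Fin b, ∑ x, ∫ ω, f p (c x p) ω * f q (c x q) ω ∂μ ≤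
      if p.1 = q.1 then (Fintype.card X : ℝ) else 0 := by
    intro p q
    split_ifs with hpq
    · refine (Finset.sum_le_card_nsmul _ _ 1 fun x _ => ?_).trans (by simp)
      refine (integral_mono (hff_int _ _ _ _) (integrable_const 1)
        fun ω => (abs_le.1 (hff_abs p q _ _ ω)).2).trans ?_
      simp
    · obtain ⟨φ, hφ, hφc⟩ := hc p q fun h => hpq (by rw [h])
      have h1 := sum_comp_mul_card φ hφ
        fun y => (μ.real (E p y.1) - d p) * (μ.real (E q y.2) - d q)
      rw [Fintype.sum_prod_type] at h1
      dsimp only at h1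
      rw [← Finset.sum_mul_sum, hsum0, zero_mul, mul_zero] at h1
      simp only [hφc, ← hcov p q hpq] at h1
      have h2 : (Fintype.card (Y × Y) : ℝ) ≠ 0 := by
        rw [Fintype.card_prod]
        push_cast
        positivity
      exact ((mul_eq_zero.1 h1).resolve_right h2).le
  set T : ℝ := (θ - δ) * (k * b) with hT
  have hkb : (0 : ℝ) < k * b := by positivity
  have hTpos : 0 < T := mul_pos (sub_pos.2 hθ) hkb
  have hcheb : ∀ x, T ^ 2 *
      μ.real {ω | θ * (k * b) ≤ ∑ p, (E p (c x p)).indicator (fun _ => (1 : ℝ)) ω} ≤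
      ∑ p, ∑ q, ∫ ω, f p (c x p) ω * f q (c x q) ω ∂μ := by
    intro x
    have hsq : ∀ ω, (∑ p, f p (c x p) ω) ^ 2 = ∑ p, ∑ q, f p (c x p) ω * f q (c x q) ω :=
      fun ω => by rw [sq, Finset.sum_mul_sum]
    have hint : Integrable (fun ω => (∑ p, f p (c x p) ω) ^ 2) μ := by
      simp only [hsq]
      exact integrable_finsetSum _ fun p _ => integrable_finsetSum _ fun q _ => hff_int _ _ _ _
    have h1 := mul_meas_ge_le_integral_of_nonneg
      (Eventually.of_forall fun ω => sq_nonneg (∑ p, f p (c x p) ω)) hint (T ^ 2)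
    have h2 : ∫ ω, (∑ p, f p (c x p) ω) ^ 2 ∂μ =
        ∑ p, ∑ q, ∫ ω, f p (c x p) ω * f q (c x q) ω ∂μ := by
      simp only [hsq]
      rw [integral_finsetSum _ fun p _ => integrable_finsetSum _ fun q _ => hff_int _ _ _ _]
      refine Finset.sum_congr rfl fun p _ => ?_
      rw [integral_finsetSum _ fun q _ => hff_int _ _ _ _]
    rw [h2] at h1
    refine le_trans ?_ h1
    refine mul_le_mul_of_nonneg_left (measureReal_mono fun ω hω => ?_) (sq_nonneg T)
    simp only [Set.mem_ofPred_eq] at hω ⊢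
    refine pow_le_pow_left₀ hTpos.le ?_ 2
    simp only [f, Finset.sum_sub_distrib]
    have h3 : ∑ p, d p ≤ δ * (k * b) := by
      refine (Finset.sum_le_card_nsmul _ _ δ fun p _ => hδ p).trans (le_of_eq ?_)
      simp
      ring
    rw [hT]
    linarith
  have htotal : T ^ 2 *
      ∑ x, μ.real {ω | θ * (k * b) ≤ ∑ p, (E p (c x p)).indicator (fun _ => (1 : ℝ)) ω} ≤
      Fintype.card X * (k * b ^ 2) := by
    rw [Finset.mul_sum]
    refine (Finset.sum_le_sum fun x _ => hcheb x).trans ?_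
    rw [Finset.sum_comm]
    calc _ = ∑ p, ∑ q, ∑ x, ∫ ω, f p (c x p) ω * f q (c x q) ω ∂μ :=
          Finset.sum_congr rfl fun p _ => Finset.sum_comm
      _ ≤ ∑ p : Fin k × Fin b, ∑ q : Fin k × Fin b,
          if p.1 = q.1 then (Fintype.card X : ℝ) else 0 :=
          Finset.sum_le_sum fun p _ => Finset.sum_le_sum fun q _ => hpair p q
      _ = Fintype.card X * (k * b ^ 2) := by
          have : ∀ p : Fin k × Fin b, ∑ q : Fin k × Fin b,
              (if p.1 = q.1 then (Fintype.card X : ℝ) else 0) = b * Fintype.card X := by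
            intro p
            rw [Fintype.sum_prod_type_right]
            simp
          simp only [this]
          simp
          ring
  rw [div_le_div_iff₀ hX (by have := sub_pos.2 hθ; positivity)]
  have h5 : T ^ 2 = (k * (θ - δ) ^ 2) * (k * b ^ 2) := by rw [hT]; ring
  rw [h5] at htotal
  have h6 : (0 : ℝ) < k * b ^ 2 := by positivity
  refine le_of_mul_le_mul_right ?_ h6
  linarith

/-! ### Sylvester's Hadamard matrices and decoding -/

lemma exists_isHadamard_two_pow (s : ℕ) :
    ∃ H : Matrix (Fin (2 ^ s)) (Fin (2 ^ s)) ℝ, H.IsHadamard := by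
  induction s with
  | zero => exact ⟨1, by constructor <;> simp [Matrix.one_apply, Unitary.mem_iff]⟩
  | succ s ih =>
    obtain ⟨H, hH⟩ := ih
    have h2 : (!![1, 1; 1, -1] : Matrix (Fin 2) (Fin 2) ℝ).IsHadamard := by
      constructor
      · intro i j
        fin_cases i <;> fin_cases j <;> simp [Unitary.mem_iff]
      all_goals
        ext i j
        fin_cases i <;> fin_cases j <;>
          norm_num [Matrix.mul_apply, Fin.sum_univ_two, Matrix.conjTranspose_apply]
    exact ⟨_, (hH.kronecker h2).reindex finProdFinEquiv finProdFinEquiv⟩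

/-- There are orthogonal transforms of order `2 ^ s` with entries `±2 ^ (-s/2)`. -/
lemma exists_sign_transform (s : ℕ) :
    ∃ H : Fin (2 ^ s) → Fin (2 ^ s) → ℝ, (∀ l j, |H l j| = 1) ∧
      ∀ l l', ∑ j, ((√((2 ^ s : ℕ) : ℝ))⁻¹ * H l j) * ((√((2 ^ s : ℕ) : ℝ))⁻¹ * H l' j) =
        if l = l' then 1 else 0 := by
  obtain ⟨H, hH⟩ := exists_isHadamard_two_pow s
  refine ⟨H, fun l j => ?_, fun l l' => ?_⟩
  · have := (Unitary.mem_iff.1 (hH.apply_mem l j)).1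
    rw [star_trivial, ← sq, sq_eq_one_iff] at this
    rcases this with h | h <;> simp [h]
  · have h1 := congrFun (congrFun hH.mul_conjTranspose l) l'
    simp only [Matrix.mul_apply, Matrix.conjTranspose_apply, star_trivial, Fintype.card_fin,
      Matrix.smul_apply, Matrix.one_apply, smul_eq_mul] at h1
    have hb : (0 : ℝ) < ((2 ^ s : ℕ) : ℝ) := by positivity
    have h2 : ∀ j, ((√((2 ^ s : ℕ) : ℝ))⁻¹ * H l j) * ((√((2 ^ s : ℕ) : ℝ))⁻¹ * H l' j) =
        (((2 ^ s : ℕ) : ℝ))⁻¹ * (H l j * H l' j) := by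
      intro j
      rw [mul_mul_mul_comm, ← mul_inv, Real.mul_self_sqrt hb.le]
    simp only [h2, ← Finset.mul_sum, h1]
    split_ifs
    · rw [mul_one, inv_mul_cancel₀ hb.ne']
    · simp

/-- Bounded distance decoding. -/
lemma exists_decoder {J X S A W : Type*} [Fintype J] [DecidableEq S] [DecidableEq A]
    [Nonempty W] {e : ℕ} (c : X → J → S)
    (hc : ∀ x x', x ≠ x' → 2 * e < hammingDist (c x) (c x')) (mem : W ↪ X) (emb : S ↪ A) :
    ∃ dcd : (J → A) → W, ∀ w y,
      hammingDist (fun j => emb (c (mem w) j)) y ≤ e → dcd y = w := by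
  classical
  refine ⟨fun y => if h : ∃ w, hammingDist (fun j => emb (c (mem w) j)) y ≤ e then h.choose
    else Classical.arbitrary W, fun w y hw => ?_⟩
  have h : ∃ w, hammingDist (fun j => emb (c (mem w) j)) y ≤ e := ⟨w, hw⟩
  simp only [dif_pos h]
  by_contra hne
  have h1 := hc _ _ fun h' => hne (mem.injective h')
  have h2 : hammingDist (c (mem h.choose)) (c (mem w)) =
      hammingDist (fun j => emb (c (mem h.choose) j)) (fun j => emb (c (mem w) j)) :=
    (hammingDist_comp (fun _ => emb) fun _ => emb.injective).symm
  have h3 := hammingDist_triangle (fun j => emb (c (mem h.choose) j)) y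
    (fun j => emb (c (mem w) j))
  have h4 := h.choose_spec
  rw [hammingDist_comm y] at h3
  omega

lemma card_pi_le_two_pow_mul {L : ℕ} {A B : Fin L → Type*} [∀ i, Fintype (A i)]
    [∀ i, Fintype (B i)] (h : ∀ i, Fintype.card (A i) ≤ 2 * Fintype.card (B i)) :
    (Fintype.card ((i : Fin L) → A i) : ℝ) ≤ 2 ^ L * Fintype.card ((i : Fin L) → B i) := by
  rw [Fintype.card_pi, Fintype.card_pi]
  have : ∏ i, Fintype.card (A i) ≤ 2 ^ L * ∏ i, Fintype.card (B i) := by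
    calc ∏ i, Fintype.card (A i) ≤ ∏ i, 2 * Fintype.card (B i) :=
          Finset.prod_le_prod' fun i _ => h i
      _ = 2 ^ L * ∏ i, Fintype.card (B i) := by simp [Finset.prod_mul_distrib]
  exact_mod_cast this

/-! ### Inner schemes combined with outer codes -/

/-- From an inner scheme and parameters that admit outer codes, a scheme for a longer block whose
error probability is controlled, for all noise laws, by those of the inner scheme under signed
averages of the noise. -/
theorem CodingScheme.exists_interleaved {V : Type*} [Fintype V] {L : ℕ} {N : UnicastNetwork V L}
    {P : ℝ} (hP : 0 ≤ P) {n : ℕ} {R : Fin L → ℝ} (C : CodingScheme N P n R) {ρ : ℕ}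
    (hC : C.HasReadingPrecision ρ) {k b m e : ℕ} (hk : 0 < k) (hb : 0 < b) (h : k * (n * b) ≤ m)
    {H : Fin b → Fin b → ℝ} (hH1 : ∀ l j, |H l j| = 1)
    (hQ : ∀ l l', ∑ j, ((√(b : ℝ))⁻¹ * H l j) * ((√(b : ℝ))⁻¹ * H l' j) = if l = l' then 1 else 0)
    {R' : Fin L → ℝ} (a K : Fin L → ℕ)
    (ha : ∀ i, 2 ^ a i ≤ Fintype.card (MessageSet n (R i)))
    (ha' : ∀ i, Fintype.card (MessageSet n (R i)) ≤ 2 * 2 ^ a i)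
    (hK : ∀ i, Fintype.card (MessageSet m (R' i)) ≤ 2 ^ K i)
    (hK' : ∀ i, 2 ^ K i ≤ 2 * Fintype.card (MessageSet m (R' i)))
    (hcode : ∀ i, (a i = 0 ∧ K i = 0) ∨
      (K i + k * b + 2 * a i * e + 2 ≤ a i * (k * b) ∧ 2 * (k * b) + 2 * a i + 2 ≤ K i)) :
    ∃ D : CodingScheme N P m R', ∀ ν : V → Measure ℝ, (∀ v, IsProbabilityMeasure (ν v)) →
      ∀ δ θ : ℝ, (∀ σ : Fin b → ℝ, (∀ j, |σ j| = 1) →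
        C.errorProb (fun v => mixLaw (ν v) σ) ≤ δ) → 2 ^ L * δ < θ →
        θ * (k * b) ≤ e + 1 → D.errorProb ν ≤ 2 ^ L / (k * (θ - 2 ^ L * δ) ^ 2) := by
  classical
  have hcode' := fun i => exists_linear_code (Fin k × Fin b) (a i) (K i) e
    (by simpa using hcode i)
  choose c hcmin hcsurj using hcode'
  have hmem : ∀ i, Nonempty (MessageSet m (R' i) ↪ (Fin (K i) → ZMod 2)) := fun i =>
    Function.Embedding.nonempty_of_card_le (by simpa [ZMod.card] using hK i)
  have hemb : ∀ i, Nonempty ((Fin (a i) → ZMod 2) ↪ MessageSet n (R i)) := fun i =>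
    Function.Embedding.nonempty_of_card_le (by simpa [ZMod.card] using ha i)
  let mem := fun i => (hmem i).some
  let emb := fun i => (hemb i).some
  have hmpos : ∀ i, 0 < Fintype.card (MessageSet m (R' i)) := fun i => by
    have := hK' i
    have : 0 < 2 ^ K i := by positivity
    omega
  have hne : ∀ i, Nonempty (MessageSet m (R' i)) := fun i => Fintype.card_pos_iff.1 (hmpos i)
  have hdist : ∀ i x x', x ≠ x' → 2 * e < hammingDist (c i x) (c i x') := by
    intro i x x' hx
    rw [hammingDist_eq_hammingNorm, ← map_neg, ← map_add]
    refine hcmin i _ fun h0 => hx ?_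
    exact neg_add_eq_zero.1 h0
  choose dcd hdcd using fun i => exists_decoder (c i) (hdist i) (mem i) (emb i)
  let cw : (i : Fin L) → MessageSet m (R' i) → Fin k → Fin b → MessageSet n (R i) :=
    fun i x g l => emb i (c i (mem i x) (g, l))
  refine ⟨C.interleave h hQ hP cw fun i y => dcd i fun p => y p.1 p.2, ?_⟩
  intro ν hν δ θ hδ hθ hθe
  let X := (i : Fin L) → Fin (K i) → ZMod 2
  let Y := (i : Fin L) → Fin (a i) → ZMod 2
  let cc : X → Fin k × Fin b → Y := fun x p i => c i (x i) p
  let Z : Fin k → Fin b → (V × Fin m → ℝ) → (V × Fin n → ℝ) := fun g l z =>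
    innerNoise h (fun i j => (√(b : ℝ))⁻¹ * H i j) z g l
  let word : Y → (i : Fin L) → MessageSet n (R i) := fun y i => emb i (y i)
  have hword : Function.Injective word := fun y y' hyy =>
    funext fun i => (emb i).injective (congrFun hyy i)
  let E : Fin k × Fin b → Y → Set (V × Fin m → ℝ) := fun p y =>
    Z p.1 p.2 ⁻¹' C.errorSet (word y)
  have hZ : ∀ g l, Measurable (Z g l) := fun g l => measurable_innerNoise h _ g l
  have hE : ∀ p y, MeasurableSet (E p y) := fun p y => hZ _ _ (hC.measurableSet_errorSet _)
  have hYpos : (0 : ℝ) < Fintype.card Y := by exact_mod_cast Fintype.card_pos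
  have hXpos : (0 : ℝ) < Fintype.card X := by exact_mod_cast Fintype.card_pos
  -- Outer symbols use only `2 ^ a i` of the inner messages, at least half of them for each `i`,
  -- which can raise the average error by a factor `2 ^ L`.
  have havg : ∀ p, (∑ y, (noiseLaw ν m).real (E p y)) / Fintype.card Y ≤ 2 ^ L * δ := by
    intro p
    have h1 : ∑ y, (noiseLaw ν m).real (E p y) ≤ ∑ w : (i : Fin L) → MessageSet n (R i),
        (noiseLaw (fun v => mixLaw (ν v) (H p.2)) n).real (C.errorSet w) := by
      simp only [E, Z, measureReal_innerNoise_preimage h H ν p.1 p.2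
        (hC.measurableSet_errorSet _)]
      rw [← Finset.sum_image (s := Finset.univ) (g := word)
        (f := fun w => (noiseLaw (fun v => mixLaw (ν v) (H p.2)) n).real (C.errorSet w))
        (fun _ _ _ _ hyy => hword hyy)]
      exact Finset.sum_le_sum_of_subset_of_nonneg (Finset.subset_univ _)
        fun _ _ _ => measureReal_nonneg
    have h2 := hδ (H p.2) (hH1 p.2)
    have h3 := card_pi_le_two_pow_mul (A := fun i => MessageSet n (R i))
      (B := fun i => Fin (a i) → ZMod 2) (fun i => by simpa [ZMod.card] using ha' i)
    have h4 : (0 : ℝ) < Fintype.card ((i : Fin L) → MessageSet n (R i)) :=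
      hYpos.trans_le (by exact_mod_cast Fintype.card_le_of_injective word hword)
    rw [errorProb, div_le_iff₀ h4] at h2
    have hδ0 : 0 ≤ δ := by
      refine nonneg_of_mul_nonneg_left (le_trans ?_ h2) h4
      exact Finset.sum_nonneg fun _ _ => measureReal_nonneg
    rw [div_le_iff₀ hYpos]
    calc _ ≤ δ * Fintype.card ((i : Fin L) → MessageSet n (R i)) := h1.trans h2
      _ ≤ δ * (2 ^ L * Fintype.card Y) := by gcongr
      _ = _ := by ring
  have hsecond := sum_measureReal_many_bad_le hk hb (noiseLaw ν m) cc (by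
      intro p q hpq
      refine ⟨{ toFun := fun x => (cc x p, cc x q)
                map_zero' := by
                  refine Prod.ext ?_ ?_ <;> funext i <;> exact congrFun (map_zero (c i)) _
                map_add' := fun x x' => by
                  refine Prod.ext ?_ ?_ <;> funext i <;>
                    exact congrFun (map_add (c i) (x i) (x' i)) _ }, fun y => ?_, fun x => rfl⟩
      choose x hx using fun i => hcsurj i p q hpq (y.1 i, y.2 i)
      refine ⟨x, ?_⟩
      refine Prod.ext ?_ ?_ <;> funext i
      · exact congrArg Prod.fst (hx i)
      · exact congrArg Prod.snd (hx i)) E hE (by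
      intro p q hpq y y'
      have hind := indepFun_innerNoise (n := n) h H ν hpq p.2 q.2
      have := hind.measure_inter_preimage_eq_mul _ _
        (hC.measurableSet_errorSet (word y)) (hC.measurableSet_errorSet (word y'))
      simp only [measureReal_def, ← ENNReal.toReal_mul]
      exact congrArg ENNReal.toReal this) havg hθ
  set bad : X → Set (V × Fin m → ℝ) := fun x =>
    {ω | θ * (k * b) ≤ ∑ p, (E p (cc x p)).indicator (fun _ => (1 : ℝ)) ω} with hbad
  let memX : ((i : Fin L) → MessageSet m (R' i)) → X := fun w i => mem i (w i)
  have hmemX : Function.Injective memX := fun w w' hww =>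
    funext fun i => (mem i).injective (congrFun hww i)
  -- A copy counts as failed if any destination errs in it, so at most `e` failed copies leave every
  -- destination within decoding radius.
  have hsub : ∀ w, (C.interleave h hQ hP cw fun i y => dcd i fun p => y p.1 p.2).errorSet w ⊆
      bad (memX w) := by
    intro w z hz
    obtain ⟨i, hi⟩ := C.exists_of_mem_errorSet_interleave h hQ hP cw _ w hz
    by_contra hnb
    refine hi (hdcd i (w i) _ ?_).symm
    simp only [hbad, Set.mem_ofPred_eq, not_le, Set.indicator_apply, Finset.sum_boole] at hnb
    have h1 := hnb.trans_le hθe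
    have h2 : (Finset.univ.filter fun p => z ∈ E p (cc (memX w) p)).card ≤ e := by
      have : (Finset.univ.filter fun p => z ∈ E p (cc (memX w) p)).card < e + 1 := by
        exact_mod_cast h1
      omega
    refine le_trans (Finset.card_le_card fun p hp => ?_) h2
    rw [Finset.mem_filter] at hp ⊢
    exact ⟨Finset.mem_univ _, i, hp.2⟩
  have hMpos : (0 : ℝ) < Fintype.card ((i : Fin L) → MessageSet m (R' i)) := by
    exact_mod_cast Fintype.card_pos
  -- The actual messages fill at least half of each `Fin (K i) → ZMod 2`; this costs the second
  -- factor `2 ^ L`.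
  have hcardX := card_pi_le_two_pow_mul (A := fun i => Fin (K i) → ZMod 2)
    (B := fun i => MessageSet m (R' i)) (fun i => by simpa [ZMod.card] using hK' i)
  have hsum : ∑ w, (noiseLaw ν m).real
      ((C.interleave h hQ hP cw fun i y => dcd i fun p => y p.1 p.2).errorSet w) ≤
      ∑ x, (noiseLaw ν m).real (bad x) := by
    refine (Finset.sum_le_sum fun w _ => measureReal_mono (hsub w)).trans ?_
    rw [← Finset.sum_image (s := Finset.univ) (g := memX)
      (f := fun x => (noiseLaw ν m).real (bad x)) (fun _ _ _ _ hww => hmemX hww)]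
    exact Finset.sum_le_sum_of_subset_of_nonneg (Finset.subset_univ _)
      fun _ _ _ => measureReal_nonneg
  rw [div_le_iff₀ hXpos] at hsecond
  rw [errorProb, div_le_iff₀ hMpos]
  have hden : (0 : ℝ) < k * (θ - 2 ^ L * δ) ^ 2 := by
    have := sub_pos.2 hθ
    positivity
  calc _ ≤ 1 / (k * (θ - 2 ^ L * δ) ^ 2) * Fintype.card X := hsum.trans hsecond
    _ ≤ 1 / (k * (θ - 2 ^ L * δ) ^ 2) *
        (2 ^ L * Fintype.card ((i : Fin L) → MessageSet m (R' i))) := by gcongr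
    _ = _ := by ring

/-! ### Choice of parameters -/

lemma log_floor_two_rpow_bounds {u : ℝ} (hu : 0 ≤ u) :
    (Nat.log 2 ⌊(2 : ℝ) ^ u⌋₊ : ℝ) ≤ u ∧ u < Nat.log 2 ⌊(2 : ℝ) ^ u⌋₊ + 1 := by
  have h1 : (1 : ℝ) ≤ 2 ^ u := Real.one_le_rpow (by norm_num) hu
  have hM : ⌊(2 : ℝ) ^ u⌋₊ ≠ 0 := (Nat.floor_pos.2 h1).ne'
  constructor
  · have h2 : ((2 ^ Nat.log 2 ⌊(2 : ℝ) ^ u⌋₊ : ℕ) : ℝ) ≤ 2 ^ u :=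
      (Nat.cast_le.2 (Nat.pow_log_le_self 2 hM)).trans (Nat.floor_le (by positivity))
    rw [Nat.cast_pow, Nat.cast_ofNat, ← Real.rpow_natCast] at h2
    exact (Real.rpow_le_rpow_left_iff (by norm_num)).1 h2
  · have h2 : (2 : ℝ) ^ u < ((2 ^ (Nat.log 2 ⌊(2 : ℝ) ^ u⌋₊ + 1) : ℕ) : ℝ) := by
      refine (Nat.lt_floor_add_one _).trans_le ?_
      exact_mod_cast Nat.lt_pow_succ_log_self (by norm_num) _
    rw [Nat.cast_pow, Nat.cast_ofNat, ← Real.rpow_natCast] at h2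
    have := (Real.rpow_lt_rpow_left_iff (by norm_num)).1 h2
    push_cast at this
    exact this

lemma clog_floor_two_rpow_bounds {v : ℝ} (hv : 0 ≤ v) :
    (Nat.clog 2 ⌊(2 : ℝ) ^ v⌋₊ : ℝ) ≤ v + 1 ∧ v < Nat.clog 2 ⌊(2 : ℝ) ^ v⌋₊ + 1 := by
  set M := ⌊(2 : ℝ) ^ v⌋₊ with hM
  constructor
  · rcases le_or_gt M 1 with h | h
    · rw [Nat.clog_of_right_le_one h]
      simp
      linarith
    · have h2 : ((2 ^ (Nat.clog 2 M).pred : ℕ) : ℝ) ≤ 2 ^ v :=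
        (Nat.cast_le.2 (Nat.pow_pred_clog_lt_self (by norm_num) h).le).trans
          (Nat.floor_le (by positivity))
      rw [Nat.cast_pow, Nat.cast_ofNat, ← Real.rpow_natCast] at h2
      have h3 := (Real.rpow_le_rpow_left_iff (by norm_num)).1 h2
      have h4 : Nat.clog 2 M ≤ (Nat.clog 2 M).pred + 1 := by simp only [Nat.pred_eq_sub_one]; omega
      have h5 : (Nat.clog 2 M : ℝ) ≤ ((Nat.clog 2 M).pred : ℝ) + 1 := by exact_mod_cast h4
      linarith
  · have h2 : (2 : ℝ) ^ v < ((2 ^ (Nat.clog 2 M + 1) : ℕ) : ℝ) := by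
      refine (Nat.lt_floor_add_one _).trans_le ?_
      rw [← hM]
      have h3 := Nat.le_pow_clog (b := 2) (by norm_num) M
      have h4 : 1 ≤ 2 ^ Nat.clog 2 M := Nat.one_le_two_pow
      have : M + 1 ≤ 2 ^ (Nat.clog 2 M + 1) := by rw [pow_succ]; omega
      exact_mod_cast this
    rw [Nat.cast_pow, Nat.cast_ofNat, ← Real.rpow_natCast] at h2
    have := (Real.rpow_lt_rpow_left_iff (by norm_num)).1 h2
    push_cast at this
    exact this

/-- The parameters of the outer codes are admissible. -/
lemma outer_code_parameters {R η : ℝ} {n m k b e : ℕ} (hR : 0 ≤ R) (hη : 0 < η) (hη2 : η ≤ 1 / 2)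
    (hn : R = 0 ∨ 12 ≤ η * (n * R)) (hk : 16 ≤ k) (hkη : 2 ≤ η * k) (hb : 0 < b)
    (hm : k * (n * b) ≤ m) (hm' : m ≤ (k + 1) * (n * b)) (he : (e : ℝ) ≤ η / 8 * (k * b)) :
    (Nat.log 2 ⌊(2 : ℝ) ^ ((n : ℝ) * R)⌋₊ = 0 ∧
      Nat.clog 2 ⌊(2 : ℝ) ^ ((m : ℝ) * ((1 - η) * R))⌋₊ = 0) ∨
    (Nat.clog 2 ⌊(2 : ℝ) ^ ((m : ℝ) * ((1 - η) * R))⌋₊ + k * b +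
        2 * Nat.log 2 ⌊(2 : ℝ) ^ ((n : ℝ) * R)⌋₊ * e + 2 ≤
          Nat.log 2 ⌊(2 : ℝ) ^ ((n : ℝ) * R)⌋₊ * (k * b) ∧
      2 * (k * b) + 2 * Nat.log 2 ⌊(2 : ℝ) ^ ((n : ℝ) * R)⌋₊ + 2 ≤
        Nat.clog 2 ⌊(2 : ℝ) ^ ((m : ℝ) * ((1 - η) * R))⌋₊) := by
  -- At rate zero both message sets are singletons and the outer code is trivial.
  rcases hn with rfl | hn
  · left
    simp
  right
  have hu0 : 0 ≤ (n : ℝ) * R := by positivity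
  have hv0 : 0 ≤ (m : ℝ) * ((1 - η) * R) := by
    have : 0 ≤ 1 - η := by linarith
    positivity
  obtain ⟨ha1, ha2⟩ := log_floor_two_rpow_bounds hu0
  obtain ⟨hK1, hK2⟩ := clog_floor_two_rpow_bounds hv0
  generalize Nat.log 2 ⌊(2 : ℝ) ^ ((n : ℝ) * R)⌋₊ = a at *
  generalize Nat.clog 2 ⌊(2 : ℝ) ^ ((m : ℝ) * ((1 - η) * R))⌋₊ = K at *
  have hmr : (k : ℝ) * (n * b) ≤ m := by exact_mod_cast hm
  have hmr' : (m : ℝ) ≤ (k + 1) * (n * b) := by exact_mod_cast hm'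
  have hbr : (1 : ℝ) ≤ b := by exact_mod_cast hb
  have hkr : (16 : ℝ) ≤ k := by exact_mod_cast hk
  obtain ⟨u, hu⟩ : ∃ u, u = (n : ℝ) * R := ⟨_, rfl⟩
  obtain ⟨T, hT⟩ : ∃ T, T = (k : ℝ) * b := ⟨_, rfl⟩
  rw [← hu] at hn ha1 ha2 hu0
  rw [← hT] at he
  have hT16 : 16 ≤ T := by rw [hT]; nlinarith
  have hu24 : 24 ≤ u := by nlinarith
  have hbT : 2 * (b : ℝ) ≤ η * T := by rw [hT]; nlinarith
  have hvle : (m : ℝ) * ((1 - η) * R) ≤ u * T * (1 - η / 2) := by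
    have h1 : (m : ℝ) * ((1 - η) * R) ≤ ((k + 1) * (n * b)) * ((1 - η) * R) := by
      have : 0 ≤ (1 - η) * R := mul_nonneg (by linarith) hR
      gcongr
    have h2 : (((k : ℝ) + 1) * (n * b)) * ((1 - η) * R) = (u * (1 - η)) * (T + b) := by
      rw [hu, hT]; ring
    have h3 : (u * (1 - η)) * (T + b) ≤ (u * (1 - η)) * (T + η * T / 2) := by
      have : 0 ≤ u * (1 - η) := mul_nonneg hu0 (by linarith)
      have : (b : ℝ) ≤ η * T / 2 := by linarith
      gcongr
    have h4 : (u * (1 - η)) * (T + η * T / 2) = u * T * (1 - η / 2) - u * T * η ^ 2 / 2 := by ring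
    have h5 : 0 ≤ u * T * η ^ 2 / 2 := by positivity
    linarith
  have hvge : u * T / 2 ≤ (m : ℝ) * ((1 - η) * R) := by
    have h1 : (k : ℝ) * (n * b) * ((1 - η) * R) ≤ m * ((1 - η) * R) := by
      have : 0 ≤ (1 - η) * R := mul_nonneg (by linarith) hR
      gcongr
    have h2 : (k : ℝ) * (n * b) * ((1 - η) * R) = u * T * (1 - η) := by rw [hu, hT]; ring
    have h3 : 0 ≤ u * T * (1 / 2 - η) := mul_nonneg (by positivity) (by linarith)
    linarith
  constructor
  · have hreal : (K : ℝ) + T + 2 * a * e + 2 ≤ a * T := by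
      have h1 : (a : ℝ) * e ≤ a * (η / 8 * T) := by gcongr
      have h2 : (u - 1) * (T * (1 - η / 4)) ≤ a * (T * (1 - η / 4)) := by
        have : 0 ≤ T * (1 - η / 4) := mul_nonneg (by linarith) (by linarith)
        have : u - 1 ≤ a := by linarith
        gcongr
      have h3 : 12 * T ≤ η * u * T := by gcongr
      have h4 : 0 ≤ T * η := by positivity
      nlinarith
    rw [hT] at hreal
    exact_mod_cast hreal
  · have hreal : 2 * T + 2 * a + 2 ≤ (K : ℝ) := by
      have h1 : 0 ≤ (u - 24) * (T - 16) := mul_nonneg (by linarith) (by linarith)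
      nlinarith
    rw [hT] at hreal
    exact_mod_cast hreal

/-- The group size `b` is a power of two of order `√m`, so that a Hadamard matrix exists and, for
fixed `n`, the number `m / (n b)` of groups grows as well. -/
lemma tendsto_two_pow_log_div_two : Tendsto (fun m : ℕ => 2 ^ (Nat.log 2 m / 2)) atTop atTop := by
  refine tendsto_atTop.2 fun B => ?_
  filter_upwards [eventually_ge_atTop (2 ^ (2 * B))] with m hm
  have h1 : 2 * B ≤ Nat.log 2 m := by
    have := Nat.log_mono_right (b := 2) hm
    rwa [Nat.log_pow (by norm_num)] at this
  have h2 : B ≤ Nat.log 2 m / 2 := by omega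
  exact Nat.lt_two_pow_self.le.trans (Nat.pow_le_pow_right (by norm_num) h2)

lemma tendsto_div_mul_two_pow_log_div_two {n : ℕ} (hn : 0 < n) :
    Tendsto (fun m : ℕ => m / (n * 2 ^ (Nat.log 2 m / 2))) atTop atTop := by
  refine tendsto_atTop.2 fun B => ?_
  filter_upwards [tendsto_two_pow_log_div_two.eventually_ge_atTop (n * B),
    eventually_ne_atTop 0] with m hm hm0
  rw [Nat.le_div_iff_mul_le (by positivity)]
  calc B * (n * 2 ^ (Nat.log 2 m / 2)) = (n * B) * 2 ^ (Nat.log 2 m / 2) := by ring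
    _ ≤ 2 ^ (Nat.log 2 m / 2) * 2 ^ (Nat.log 2 m / 2) := Nat.mul_le_mul_right _ hm
    _ = 2 ^ (Nat.log 2 m / 2 + Nat.log 2 m / 2) := (pow_add _ _ _).symm
    _ ≤ 2 ^ Nat.log 2 m := Nat.pow_le_pow_right (by norm_num) (by omega)
    _ ≤ m := Nat.pow_log_le_self 2 hm0

/-! ### Conclusion -/

lemma messageSet_nonempty {n : ℕ} {r : ℝ} (hr : 0 ≤ r) : Nonempty (MessageSet n r) := by
  refine ⟨⟨0, Nat.floor_pos.2 (Real.one_le_rpow (by norm_num) (by positivity))⟩⟩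

lemma exists_codingScheme {V : Type*} {L : ℕ} (N : UnicastNetwork V L) {P : ℝ} (hP : 0 ≤ P) (n : ℕ)
    {R : Fin L → ℝ} (hR : ∀ i, 0 ≤ R i) : Nonempty (CodingScheme N P n R) :=
  ⟨{ enc := fun _ _ _ => 0
     relay := fun _ _ _ => 0
     dec := fun i _ => (messageSet_nonempty (hR i)).some
     enc_power := fun _ _ => by simpa using hP
     relay_power := fun _ _ => by simpa using hP
     relay_measurable := fun _ _ => measurable_const
     dec_measurable := fun _ => measurable_const }⟩

/-- A decoder needs a nonempty message set, which forces `2 ^ (n R) ≥ 1`. -/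
lemma CodingScheme.rate_nonneg {V : Type*} {L : ℕ} {N : UnicastNetwork V L} {P : ℝ} {n : ℕ}
    (hn : 0 < n) {R : Fin L → ℝ} (C : CodingScheme N P n R) (i : Fin L) : 0 ≤ R i := by
  have h : 0 < ⌊(2 : ℝ) ^ ((n : ℝ) * R i)⌋₊ := Fin.pos (C.dec i 0)
  have h1 : (2 : ℝ) ^ (0 : ℝ) ≤ 2 ^ ((n : ℝ) * R i) := by
    rw [Real.rpow_zero]
    exact Nat.floor_pos.1 h
  have h2 := (Real.rpow_le_rpow_left_iff (by norm_num)).1 h1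
  exact nonneg_of_mul_nonneg_right h2 (by exact_mod_cast hn)

lemma CodingScheme.power_nonneg {V : Type*} {L : ℕ} {N : UnicastNetwork V L} {P : ℝ} {n : ℕ}
    {R : Fin L → ℝ} (C : CodingScheme N P n R) (i : Fin L) : 0 ≤ P :=
  le_trans (by positivity) (C.enc_power i (C.dec i 0))

lemma CodingScheme.errorProb_nonneg {V : Type*} [Fintype V] {L : ℕ} {N : UnicastNetwork V L} {P : ℝ}
    {n : ℕ} {R : Fin L → ℝ} (C : CodingScheme N P n R) (ν : V → Measure ℝ) :
    0 ≤ C.errorProb ν :=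
  div_nonneg (Finset.sum_nonneg fun _ _ => measureReal_nonneg) (Nat.cast_nonneg _)

theorem theorem2 {V : Type*} [Fintype V] {L : ℕ} (N : UnicastNetwork V L) (P : ℝ)
    (σsq : V → ℝ≥0) (R : Fin L → ℝ)
    (hR : AchievableWithFinitePrecision N P (awgn σsq) R) :
    ∀ ε : ℝ, 0 < ε → ∃ R' : Fin L → ℝ, (∀ i, |R' i - R i| < ε) ∧
      ∃ C : (n : ℕ+) → CodingScheme N P n R',
        ∀ ν : V → Measure ℝ, (∀ v, IsNoiseLaw (ν v) (σsq v)) → Achieves C ν := by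
  intro ε hε
  obtain ⟨C, ρ, hC, hach⟩ := hR
  -- Without destinations no error can occur; with one, an encoder witnesses `0 ≤ P`.
  rcases Nat.eq_zero_or_pos L with rfl | hL
  · refine ⟨R, fun i => i.elim0, C, fun ν _ => ?_⟩
    have : ∀ n, (C n).errorProb ν = 0 := fun n => by
      have : ∀ w, (C n).errorSet w = ∅ := fun w =>
        Set.eq_empty_of_forall_notMem fun z ⟨i, _⟩ => i.elim0
      simp [CodingScheme.errorProb, this]
    simp only [Achieves, this]
    exact tendsto_const_nhds
  have hP : 0 ≤ P := (C 1).power_nonneg ⟨0, hL⟩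
  have hR0 : ∀ i, 0 ≤ R i := (C 1).rate_nonneg (by simp)
  set B : ℝ := 1 + ∑ i, R i with hB
  have hBpos : 0 < B := by
    have : 0 ≤ ∑ i, R i := Finset.sum_nonneg fun i _ => hR0 i
    linarith
  have hRB : ∀ i, R i ≤ B := fun i => by
    have := Finset.single_le_sum (f := R) (fun i _ => hR0 i) (Finset.mem_univ i)
    linarith
  set η : ℝ := min (1 / 2) (ε / (2 * B)) with hη
  have hηpos : 0 < η := lt_min (by norm_num) (by positivity)
  have hη2 : η ≤ 1 / 2 := min_le_left _ _
  have hηε : η * B ≤ ε / 2 := by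
    have : η ≤ ε / (2 * B) := min_le_right _ _
    calc η * B ≤ ε / (2 * B) * B := by gcongr
      _ = ε / 2 := by field_simp
  have hR'0 : ∀ i, 0 ≤ (1 - η) * R i := fun i => mul_nonneg (by linarith) (hR0 i)
  refine ⟨fun i => (1 - η) * R i, fun i => ?_, ?_⟩
  · have h1 : (1 - η) * R i - R i = -(η * R i) := by ring
    rw [h1, abs_neg, abs_of_nonneg (mul_nonneg hηpos.le (hR0 i))]
    have : η * R i ≤ η * B := by gcongr; exact hRB i
    linarith
  set θ : ℝ := η / 8 with hθ
  have hθpos : 0 < θ := by positivity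
  -- The outer code corrects a fraction `θ` of failures; this `δ` keeps the mean fraction `2 ^ L *
  -- δ` at `θ / 2`.
  set δ : ℝ := θ / (2 * 2 ^ L) with hδ
  have hδpos : 0 < δ := by positivity
  have hδθ : 2 ^ L * δ = θ / 2 := by rw [hδ]; field_simp
  have hcast : Tendsto (fun n : ℕ+ => ((n : ℕ) : ℝ)) atTop atTop :=
    tendsto_natCast_atTop_atTop.comp tendsto_PNat_val_atTop_atTop
  have hlarge : ∀ᶠ n : ℕ+ in atTop, ∀ i, R i = 0 ∨ 12 ≤ η * ((n : ℕ) * R i) := by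
    rw [eventually_all]
    intro i
    rcases (hR0 i).eq_or_lt with h0 | h0
    · exact Eventually.of_forall fun _ => Or.inl h0.symm
    · filter_upwards [hcast.eventually_ge_atTop (12 / (η * R i))] with n hn
      right
      rw [div_le_iff₀ (by positivity)] at hn
      linarith
  obtain ⟨n, hnδ, hnR⟩ := ((hach.eventually_lt_const hδpos).and hlarge).exists
  set k : ℕ → ℕ := fun m => m / (n * 2 ^ (Nat.log 2 m / 2)) with hk
  have hkt : Tendsto k atTop atTop := tendsto_div_mul_two_pow_log_div_two n.pos
  have hkm : ∀ m, k m * (n * 2 ^ (Nat.log 2 m / 2)) ≤ m := fun m => Nat.div_mul_le_self _ _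
  -- The scheme is chosen before `ν`, which gives universality; the noise law enters only through
  -- the inner error bound. For small `m` any scheme will do.
  have hD : ∀ m : ℕ+, ∃ D : CodingScheme N P m fun i => (1 - η) * R i,
      16 ≤ k m → 2 ≤ η * k m → ∀ ν : V → Measure ℝ, (∀ v, IsProbabilityMeasure (ν v)) →
        (∀ σ : Fin (2 ^ (Nat.log 2 m / 2)) → ℝ, (∀ j, |σ j| = 1) →
          (C n).errorProb (fun v => mixLaw (ν v) σ) ≤ δ) →
        D.errorProb ν ≤ 2 ^ L / (k m * (θ / 2) ^ 2) := by
    intro m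
    by_cases hgood : 16 ≤ k m ∧ 2 ≤ η * k m
    swap
    · obtain ⟨D⟩ := exists_codingScheme N hP m hR'0
      exact ⟨D, fun h1 h2 => (hgood ⟨h1, h2⟩).elim⟩
    obtain ⟨hk16, hkη⟩ := hgood
    let b : ℕ := 2 ^ (Nat.log 2 (m : ℕ) / 2)
    obtain ⟨H, hH1, hQ⟩ : ∃ H : Fin b → Fin b → ℝ, _ := exists_sign_transform (Nat.log 2 m / 2)
    have hbpos : 0 < b := by positivity
    have hm' : (m : ℕ) ≤ (k m + 1) * (n * b) := by
      have := Nat.lt_div_mul_add (a := (m : ℕ)) (b := n * b) (by positivity)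
      rw [add_mul, one_mul]
      exact this.le
    have hMpos : ∀ i, ⌊(2 : ℝ) ^ (((n : ℕ) : ℝ) * R i)⌋₊ ≠ 0 := fun i =>
      (Fin.pos (messageSet_nonempty (n := n) (hR0 i)).some).ne'
    have hM'pos : ∀ i, 0 < ⌊(2 : ℝ) ^ (((m : ℕ) : ℝ) * ((1 - η) * R i))⌋₊ := fun i =>
      Fin.pos (messageSet_nonempty (n := m) (hR'0 i)).some
    obtain ⟨D, hD⟩ := (C n).exists_interleaved hP (hC n).2 (m := m) (k := k m) (b := b)
      (e := ⌊θ * (k m * b)⌋₊) (by omega) hbpos (hkm m) hH1 hQ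
      (fun i => Nat.log 2 ⌊(2 : ℝ) ^ (((n : ℕ) : ℝ) * R i)⌋₊)
      (fun i => Nat.clog 2 ⌊(2 : ℝ) ^ (((m : ℕ) : ℝ) * ((1 - η) * R i))⌋₊)
      (fun i => by simpa using Nat.pow_log_le_self 2 (hMpos i))
      (fun i => by
        rw [Fintype.card_fin, ← pow_succ']
        exact (Nat.lt_pow_succ_log_self (by norm_num) _).le)
      (fun i => by simpa using Nat.le_pow_clog (by norm_num) _)
      (fun i => by
        rw [Fintype.card_fin]
        rcases Nat.lt_or_ge 1 ⌊(2 : ℝ) ^ (((m : ℕ) : ℝ) * ((1 - η) * R i))⌋₊ with h1 | h1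
        · have h2 := Nat.pow_pred_clog_lt_self (b := 2) (by norm_num) h1
          have h3 := Nat.clog_pos (b := 2) (by norm_num) h1
          rw [← Nat.succ_pred_eq_of_pos h3, pow_succ]
          omega
        · rw [Nat.clog_of_right_le_one h1]
          have := hM'pos i
          omega)
      (fun i => outer_code_parameters (hR0 i) hηpos hη2 (hnR i) hk16 hkη hbpos (hkm m) hm'
        (Nat.floor_le (by positivity)))
    refine ⟨D, fun _ _ ν hν hσ => ?_⟩
    have := hD ν hν δ θ hσ (by rw [hδθ]; linarith) (Nat.lt_floor_add_one _).le
    rwa [hδθ, show θ - θ / 2 = θ / 2 by ring] at this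
  choose D hD using hD
  refine ⟨D, fun ν hν => ?_⟩
  -- The threshold `b₀` depends on `ν`, but only decides from which block length on the bound holds.
  obtain ⟨b₀, hb₀⟩ := (hC n).2.exists_forall_errorProb_mixLaw_lt hnδ hν
  have hkt' : Tendsto (fun m : ℕ+ => k m) atTop atTop := hkt.comp tendsto_PNat_val_atTop_atTop
  have hktr : Tendsto (fun m : ℕ+ => (k m : ℝ)) atTop atTop :=
    tendsto_natCast_atTop_atTop.comp hkt'
  have hbt : Tendsto (fun m : ℕ+ => 2 ^ (Nat.log 2 (m : ℕ) / 2)) atTop atTop :=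
    tendsto_two_pow_log_div_two.comp tendsto_PNat_val_atTop_atTop
  refine squeeze_zero' (g := fun m : ℕ+ => 2 ^ L / (k m * (θ / 2) ^ 2))
    (Eventually.of_forall fun m => (D m).errorProb_nonneg ν) ?_ ?_
  · filter_upwards [hkt'.eventually_ge_atTop 16, hktr.eventually_ge_atTop (2 / η),
      hbt.eventually_ge_atTop b₀] with m h1 h2 h3
    rw [div_le_iff₀ hηpos] at h2
    exact hD m h1 (by linarith) ν (fun v => (hν v).isProbabilityMeasure)
      fun σ hσ => (hb₀ _ h3 σ hσ).le
  · exact tendsto_const_nhds.div_atTop (hktr.atTop_mul_const (by positivity))
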